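/- **Theorem 4.5.** Let $p$ be an odd prime, let $m\ge 3$ and $l\ge 1$ be integers with $\gcd(m,l)=1$, put $q=p^m$ and $n=q-1$, and let $\alpha$ be a primitive element of $\mathbb{F}_q$. Let $\mathcal{C}_2$ be the cyclic code of length $n$ over $\mathbb{F}_p$ whose parity-check polynomial is $h_1(x)h_3(x)$, where $h_1$ and $h_3$ are the minimal polynomials over $\mathbb{F}_p$ of $\alpha$ and $\alpha^{p^l+1}$; that is, $\mathcal{C}_2$ consists of the words $(c_0,\dots,c_{n-1})$ for which $\sum_i c_ix^i$ is divisible by $(x^n-1)/(h_1(x)h_3(x))$. For a code $\mathcal{C}$, let $\mathcal{C}^\perp$ be its dual with respect to the standard inner product, and let $\overline{\mathcal{C}}$ be the extended code, obtained by appending to each codeword a coordinate that makes the sum of all its coordinates $0$. Consider the code $\overline{\mathcal{C}_2^{\perp}}^{\perp}$ of length $p^m$. For a suitable labelling of its coordinates by the elements of $\mathbb{F}_q$, $$\overline{\mathcal{C}_2^{\perp}}^{\perp}=\{(\mathrm{Tr}(ax^{p^l+1}+bx)+h)_{x\in\mathbb{F}_q} : a,b\in\mathbb{F}_q,\ h\in\mathbb{F}_p\},$$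 where $\mathrm{Tr}$ is the trace from $\mathbb{F}_q$ to $\mathbb{F}_p$. A (simple, nontrivial) $t$-$(v,k,\lambda)$ design, where $0<t<k<v$, consists of a $v$-element set of points and a set of $k$-element subsets of it, called blocks, such that every $t$-element set of points is contained in exactly $\lambda$ blocks. For each of the pairs $(i,\lambda)$ below, $i$ and $\lambda$ are natural numbers, and the set of the supports of the codewords of Hamming weight $i$ in $\overline{\mathcal{C}_2^{\perp}}^{\perp}$ is the block set of a $2$-$(p^m,i,\lambda)$ design on the set of coordinate positions. If $m\ge 3$ is odd: 1. $i=p^m-p^{m-1}$ and $\lambda=(p^m-p^{m-1}-1)(p^{m-1}+1)$. 2. $i=p^m-p^{m-1}+p^{\frac{m-1}{2}}$ and $\lambda=\frac12 p^{\frac{m-1}{2}}\left(p^{\frac{m+1}{2}}-p^{\frac{m-1}{2}}+1\right)\left(p^m-p^{m-1}+p^{\frac{m-1}{2}}-1\right)$. 3. $i=p^m-p^{m-1}-p^{\frac{m-1}{2}}$ and $\lambda=\frac12 p^{\frac{m-1}{2}}\left(p^{\frac{m+1}{2}}-p^{\frac{m-1}{2}}-1\right)\left(p^m-p^{m-1}-p^{\frac{m-1}{2}}-1\right)$.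 If $m\ge 4$ is even, with $\varepsilon=(-1)^{m/2}$: 1. $i=p^m-p^{m-1}$ and $\lambda=(p^m-p^{m-1}-1)(p^{m-1}-p^{m-2}+1)$. 2. $i=p^{\frac m2-1}(p-1)(p^{\frac m2}-\varepsilon)$ and $\lambda=\dfrac{p^{\frac m2}(p^{\frac m2}-\varepsilon)\left[p^{\frac m2-1}(p-1)(p^{\frac m2}-\varepsilon)-1\right]}{p+1}$. 3. $i=p^{\frac m2-1}\left[p^{\frac m2}(p-1)+\varepsilon\right]$ and $\lambda=\dfrac{p^{\frac m2}\left[p^{\frac m2}(p-1)+\varepsilon\right]\left[p^{m-1}(p-1)+\varepsilon p^{\frac m2-1}-1\right]}{p+1}$. 4. $i=p^{\frac m2}(p-1)\left[p^{\frac m2-1}+\varepsilon\right]$ and $\lambda=\dfrac{p^{\frac m2-2}\left[p^{\frac m2-1}+\varepsilon\right]\left[p^{\frac m2}(p-1)(p^{\frac m2-1}+\varepsilon)-1\right]}{p+1}$. 5. $i=p^{\frac m2}\left[p^{\frac m2-1}(p-1)-\varepsilon\right]$ and $\lambda=\dfrac{p^{\frac m2-2}\left[p^{\frac m2-1}(p-1)-\varepsilon\right]\left[p^{m-1}(p-1)-\varepsilon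 p^{\frac m2}-1\right]}{p+1}$. -/

import Mathlib

open Polynomial

section CodingTheory

variable {K : Type*} [Field K]

/-- The polynomial `c₀ + c₁ X + ⋯ + c_{n-1} X ^ (n-1)` attached to a word of length `n`. -/
noncomputable def wordPoly {n : ℕ} (c : Fin n → K) : K[X] :=
  ∑ i : Fin n, C (c i) * X ^ (i : ℕ)

/-- The cyclic code of length `n` whose parity-check polynomial is `h` (a divisor of `X ^ n - 1`):
the words whose polynomial is a multiple of the generator polynomial `(X ^ n - 1) / h`. -/
noncomputable def cyclicCode (n : ℕ) (h : K[X]) : Submodule K (Fin n → K) where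
  carrier := {c | (X ^ n - 1) / h ∣ wordPoly c}
  add_mem' := by
    intro a b ha hb
    have e : wordPoly (a + b) = wordPoly a + wordPoly b := by
      simp [wordPoly, add_mul, Finset.sum_add_distrib]
    simp only [Set.mem_ofPred_eq] at ha hb ⊢
    rw [e]
    exact dvd_add ha hb
  zero_mem' := by simp [wordPoly]
  smul_mem' := by
    intro r a ha
    have e : wordPoly (r • a) = C r * wordPoly a := by
      simp [wordPoly, Finset.mul_sum, mul_assoc]
    simp only [Set.mem_ofPred_eq] at ha ⊢
    rw [e]
    exact Dvd.dvd.mul_left ha _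

/-- The dual code, with respect to the standard inner product. -/
def dualCode {ι : Type*} [Fintype ι] (D : Submodule K (ι → K)) : Submodule K (ι → K) where
  carrier := {x | ∀ c ∈ D, ∑ i, c i * x i = 0}
  add_mem' := by
    intro a b ha hb c hc
    simp [mul_add, Finset.sum_add_distrib, ha c hc, hb c hc]
  zero_mem' := by
    intro c _
    simp
  smul_mem' := by
    intro r a ha c hc
    have e : ∑ i, c i * (r • a) i = r * ∑ i, c i * a i := by
      rw [Finset.mul_sum]
      exact Finset.sum_congr rfl fun i _ => by simp [mul_left_comm]
    rw [e, ha c hc, mul_zero]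

/-- The extended code: the words `(c₀, …, c_n)` with `(c₀, …, c_{n-1})` in the code
and `c₀ + ⋯ + c_n = 0`. -/
def extendedCode {n : ℕ} (D : Submodule K (Fin n → K)) : Submodule K (Fin (n + 1) → K) where
  carrier := {c | (fun i : Fin n => c i.castSucc) ∈ D ∧ ∑ i, c i = 0}
  add_mem' := by
    intro a b ha hb
    refine ⟨D.add_mem ha.1 hb.1, ?_⟩
    simp [Finset.sum_add_distrib, ha.2, hb.2]
  zero_mem' := ⟨D.zero_mem, by simp⟩
  smul_mem' := by
    intro r a ha
    refine ⟨D.smul_mem r ha.1, ?_⟩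
    have e : ∑ i, (r • a) i = r * ∑ i, a i := by simp [Finset.mul_sum]
    rw [e, ha.2, mul_zero]

/-- The support of a word. -/
def wordSupport {ι : Type*} [Fintype ι] [DecidableEq K] (c : ι → K) : Finset ι :=
  Finset.univ.filter fun i => c i ≠ 0

/-- The set of the supports of the codewords of Hamming weight `i`
(a set, so proportional codewords give one support). -/
def supportsOfWeight {ι : Type*} [Fintype ι] [DecidableEq K] (D : Submodule K (ι → K)) (i : ℕ) :
    Set (Finset ι) :=
  {B | ∃ c ∈ D, hammingNorm c = i ∧ wordSupport c = B}

/-- `(P, 𝓑)` is a simple nontrivial `t`-`(v, k, lam)` design. -/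
structure IsTDesign {P : Type*} [Fintype P] (𝓑 : Set (Finset P)) (t v k lam : ℕ) : Prop where
  card_points : Fintype.card P = v
  t_pos : 0 < t
  t_lt : t < k
  lt_v : k < v
  card_block : ∀ B ∈ 𝓑, B.card = k
  balanced : ∀ T : Finset P, T.card = t → {B ∈ 𝓑 | T ⊆ B}.ncard = lam

/-- The supports of the codewords of weight `i` form a `t`-`(v, i, lam)` design. The numbers `i`
and `lam` are given as rationals, and are required to be natural numbers, so that they can be
written with exact subtraction and division. -/
def HoldsDesign {ι : Type*} [Fintype ι] [DecidableEq K] (D : Submodule K (ι → K))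
    (t v : ℕ) (i lam : ℚ) : Prop :=
  ∃ i' lam' : ℕ, (i' : ℚ) = i ∧ (lam' : ℚ) = lam ∧
    IsTDesign (supportsOfWeight D i') t v i' lam'

end CodingTheory

/-- The cyclic code `C₂` over `𝔽_p` of length `p ^ m - 1`, whose parity-check polynomial is the
product of the minimal polynomials of `α` and `α ^ (p ^ l + 1)`. -/
noncomputable def codeC2 (p m l : ℕ) [Fact p.Prime] {F : Type*} [Field F] [Algebra (ZMod p) F]
    (α : F) : Submodule (ZMod p) (Fin (p ^ m - 1) → ZMod p) :=
  cyclicCode (p ^ m - 1) (minpoly (ZMod p) α * minpoly (ZMod p) (α ^ (p ^ l + 1)))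

/-- The dual of the extension of the dual of `C₂`, of length `(p ^ m - 1) + 1`. -/
noncomputable def codeC2Bar (p m l : ℕ) [Fact p.Prime] {F : Type*} [Field F] [Algebra (ZMod p) F]
    (α : F) : Submodule (ZMod p) (Fin (p ^ m - 1 + 1) → ZMod p) :=
  dualCode (extendedCode (dualCode (codeC2 p m l α)))

/-! Write `q = p^m`, `s(x) = x^(p^l)` and `Q_a(x) = Tr(a x s(x))`, a quadratic form over `𝔽_p`.
Expanding traces over the Galois group puts the trace words in the cyclic code, and Fourier
inversion over the `n`-th roots of unity gives the converse (`mem_cyclicCode_iff_exists_trace`).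
Dualizing, extending and dualizing again adds the constants (`codeC2Bar_eq`), so the words are
`Q_a(x) + Tr(bx) + h`.

This code is invariant under the doubly transitive group of maps `x ↦ ux + v`, `u ≠ 0`, so the
supports of weight `w` form a 2-design (`exists_isTDesign`). Words of that weight with equal
supports are proportional, because no nonzero word has too many zeros. Double counting then gives `λ
q(q-1)(p-1) = A w(w-1)`, where `A` is the number of words of weight `w`.

It remains to count words by zeros. If `b` lies in the range of the polar map of `Q_a`, completing
the square turns the zeros into a level set of `Q_a`; otherwise there are exactly `q/p` zeros
(`card_zeroCount_eq`). The level sets of `Q_a` are controlled by their second moment, which depends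
only on the size of the radical (`sum_levelCount_sq`).

For odd `m` every `Q_a` with `a ≠ 0` is nondegenerate. Multiplication by a nonsquare of `𝔽_p` pairs
the levels so that their deviations from `q/p` cancel, and the second moment gives the deviation
`±p^((m-1)/2)`.

For even `m`, `l` is odd and some `z₀ ≠ 0` satisfies `s(z₀) = -z₀`. The radical then has `1` or
`p^2` elements, the latter for exactly `(q-1)/(p+1)` nonzero `a` (`card_degenerate`). All nonzero
levels have the same size; the second moment fixes it up to a sign, and divisibility by `p+1` fixes
the sign (`levelCount_of_even`). -/

set_option linter.unusedSectionVars false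

/-! ### Quadratic trace forms: polarization, completing the square, moments of the level counts. -/

section QuadraticTraceForms

variable {p : ℕ} [Fact p.Prime] {F : Type*} [Field F] [Fintype F] [Algebra (ZMod p) F]

/-- A function that a translation of the argument shifts by a nonzero constant takes all values
equally often. -/
theorem card_fiber_of_shift {g : F → ZMod p} {r : F} {d : ZMod p} (hd : d ≠ 0)
    (hg : ∀ x, g (x + r) = g x + d) (c : ZMod p) :
    p * (Finset.univ.filter fun x => g x = c).card = Fintype.card F := by
  classical
  have hk : ∀ (k : ℕ) (x : F), g (x + k • r) = g x + k * d := by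
    intro k
    induction k with
    | zero => simp
    | succ k ih =>
      intro x
      rw [succ_nsmul, ← add_assoc, hg, ih]
      push_cast
      ring
  have hconst : ∀ c' : ZMod p, (Finset.univ.filter fun x => g x = c').card =
      (Finset.univ.filter fun x => g x = c).card := by
    intro c'
    -- Adding `r` exactly `(c - c') / d` times raises the value from `c'` to `c`.
    refine Finset.card_equiv (Equiv.addRight (((c - c') / d).val • r)) fun x => ?_
    simp only [Finset.mem_filter, Finset.mem_univ, true_and, Equiv.coe_addRight, hk,
      ZMod.natCast_val, ZMod.cast_id', id_eq]
    rw [div_mul_cancel₀ _ hd]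
    constructor
    · rintro rfl
      ring
    · intro h
      linear_combination h
  have := Finset.card_eq_sum_card_fiberwise (f := g) (s := Finset.univ) (t := Finset.univ)
    (fun _ _ => Finset.mem_coe.2 (Finset.mem_univ _))
  rw [Finset.card_univ, Finset.sum_congr rfl fun c' _ => hconst c'] at this
  simpa [ZMod.card] using this.symm

theorem exists_trace_mul_ne_zero {b : F} (hb : b ≠ 0) :
    ∃ r : F, Algebra.trace (ZMod p) F (b * r) ≠ 0 := by
  by_contra! h
  exact hb ((traceForm_nondegenerate (ZMod p) F).1 b fun r => by
    simpa [Algebra.traceForm_apply] using h r)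

theorem card_trace_mul_eq {b : F} (hb : b ≠ 0) (c : ZMod p) :
    p * (Finset.univ.filter fun x => Algebra.trace (ZMod p) F (b * x) = c).card =
      Fintype.card F := by
  obtain ⟨r, hr⟩ := exists_trace_mul_ne_zero (p := p) hb
  exact card_fiber_of_shift hr (fun x => by rw [mul_add, map_add]) c

variable (s : F ≃ₐ[ZMod p] F)

/-- The quadratic form `x ↦ Tr (a x s(x))`. -/
noncomputable def quadTrace (a x : F) : ZMod p := Algebra.trace (ZMod p) F (a * (x * s x))

/-- The linear map that represents the polar form of `quadTrace s a` in the trace form. -/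
noncomputable def polarMap (a : F) : F →ₗ[ZMod p] F :=
  LinearMap.mulLeft (ZMod p) a ∘ₗ s.toLinearMap +
    s.symm.toLinearMap ∘ₗ LinearMap.mulLeft (ZMod p) a

theorem polarMap_apply (a x : F) : polarMap s a x = a * s x + s.symm (a * x) := rfl

theorem trace_apply_algEquiv (x : F) :
    Algebra.trace (ZMod p) F (s x) = Algebra.trace (ZMod p) F x :=
  Algebra.trace_eq_of_algEquiv s x

/-- The trace is invariant under `s`, so `s.symm` moves to the other factor. The right side is
visibly symmetric in `x` and `y`, which makes `polarMap s a` self-adjoint for the trace form. -/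
theorem trace_mul_polarMap (a x y : F) :
    Algebra.trace (ZMod p) F (y * polarMap s a x) =
      Algebra.trace (ZMod p) F (a * (x * s y)) + Algebra.trace (ZMod p) F (a * (y * s x)) := by
  rw [polarMap_apply, mul_add, map_add, add_comm]
  congr 1
  · rw [← trace_apply_algEquiv s (y * s.symm (a * x)), map_mul, AlgEquiv.apply_symm_apply]
    congr 1
    ring
  · congr 1
    ring

theorem trace_mul_polarMap_comm (a x y : F) :
    Algebra.trace (ZMod p) F (y * polarMap s a x) =
      Algebra.trace (ZMod p) F (x * polarMap s a y) := by
  rw [trace_mul_polarMap, trace_mul_polarMap, add_comm]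

theorem quadTrace_add (a x y : F) :
    quadTrace s a (x + y) =
      quadTrace s a x + quadTrace s a y + Algebra.trace (ZMod p) F (polarMap s a y * x) := by
  rw [mul_comm (polarMap s a y), trace_mul_polarMap]
  simp only [quadTrace, map_add s, ← map_add (Algebra.trace (ZMod p) F)]
  congr 1
  ring

theorem quadTrace_zero_right (a : F) : quadTrace s a 0 = 0 := by simp [quadTrace]

theorem quadTrace_zero_left (x : F) : quadTrace s 0 x = 0 := by simp [quadTrace]

/-- The polar form on the diagonal is twice the quadratic form, and `2` is invertible. -/
theorem quadTrace_eq_zero_of_polarMap_eq_zero (hp : p ≠ 2) {a x : F} (hx : polarMap s a x = 0) :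
    quadTrace s a x = 0 := by
  have h := trace_mul_polarMap s a x x
  rw [hx, mul_zero, map_zero] at h
  have h2 : (2 : ZMod p) ≠ 0 := Ring.two_ne_zero (by rwa [ZMod.ringChar_zmod_n])
  refine (mul_eq_zero.1 (?_ : (2 : ZMod p) * quadTrace s a x = 0)).resolve_left h2
  rw [two_mul]
  exact h.symm

/-- The number of solutions of `Tr (a x s(x)) = c`. -/
noncomputable def levelCount (a : F) (c : ZMod p) : ℕ :=
  (Finset.univ.filter fun x => quadTrace s a x = c).card

/-- The number of zeros of `x ↦ Tr (a x s(x)) + Tr (b x) + h`. -/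
noncomputable def zeroCount (a b : F) (h : ZMod p) : ℕ :=
  (Finset.univ.filter fun x => quadTrace s a x + Algebra.trace (ZMod p) F (b * x) + h = 0).card

/-- Completing the square: substituting `x + x₀` absorbs the linear term. -/
theorem zeroCount_polarMap (a x₀ : F) (h : ZMod p) :
    zeroCount s a (polarMap s a x₀) h = levelCount s a (quadTrace s a x₀ - h) := by
  refine Finset.card_equiv (Equiv.addRight x₀) fun x => ?_
  simp only [Finset.mem_filter, Finset.mem_univ, true_and, Equiv.coe_addRight, quadTrace_add]
  constructor <;> intro h' <;> linear_combination h'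

/-- The range of a self-adjoint map is the orthogonal complement of its kernel. -/
theorem mem_range_polarMap {a b : F}
    (hb : ∀ r, polarMap s a r = 0 → Algebra.trace (ZMod p) F (b * r) = 0) :
    b ∈ LinearMap.range (polarMap s a) := by
  have hrefl : (Algebra.traceForm (ZMod p) F).IsRefl :=
    (Algebra.traceForm_isSymm (ZMod p)).isRefl
  rw [← LinearMap.BilinForm.orthogonal_orthogonal (traceForm_nondegenerate (ZMod p) F) hrefl
    (LinearMap.range (polarMap s a)), LinearMap.BilinForm.mem_orthogonal_iff]
  intro r hr
  rw [LinearMap.BilinForm.mem_orthogonal_iff] at hr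
  rw [Algebra.traceForm_apply, mul_comm]
  apply hb
  by_contra hne
  obtain ⟨y, hy⟩ := exists_trace_mul_ne_zero (p := p) hne
  apply hy
  have := hr (polarMap s a y) ⟨y, rfl⟩
  rw [Algebra.traceForm_apply] at this
  rw [mul_comm, trace_mul_polarMap_comm, mul_comm, this]

/-- Some `r` in the radical has `Tr(br) ≠ 0`. Translation by `r` leaves the quadratic part unchanged
and shifts the value by this constant, so all values are equally frequent. -/
theorem zeroCount_of_notMem_range (hp : p ≠ 2) {a b : F}
    (hb : b ∉ LinearMap.range (polarMap s a)) (h : ZMod p) :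
    p * zeroCount s a b h = Fintype.card F := by
  have : ∃ r, polarMap s a r = 0 ∧ Algebra.trace (ZMod p) F (b * r) ≠ 0 := by
    by_contra! h'
    exact hb (mem_range_polarMap s h')
  obtain ⟨r, hr, hbr⟩ := this
  refine card_fiber_of_shift (r := r) hbr (fun x => ?_) 0
  rw [quadTrace_add, hr, quadTrace_eq_zero_of_polarMap_eq_zero s hp hr, mul_add, map_add, zero_mul,
    map_zero]
  ring

/-- The number of `c` whose level set has `n` elements. -/
noncomputable def levelCountFreq (a : F) (n : ℕ) : ℕ :=
  (Finset.univ.filter fun c : ZMod p => levelCount s a c = n).card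

theorem card_zeroCount_eq_of_mem_range {a b : F} (hb : b ∈ LinearMap.range (polarMap s a))
    (n : ℕ) :
    (Finset.univ.filter fun h : ZMod p => zeroCount s a b h = n).card = levelCountFreq s a n := by
  obtain ⟨x₀, rfl⟩ := hb
  refine Finset.card_equiv (Equiv.subLeft (quadTrace s a x₀)) fun h => ?_
  simp [zeroCount_polarMap]

theorem card_range_mul_card_ker (a : F) :
    Nat.card (LinearMap.range (polarMap s a)) *
      Nat.card (LinearMap.ker (polarMap s a)) = Fintype.card F := by
  rw [← Nat.card_eq_fintype_card,
    Submodule.card_eq_card_quotient_mul_card (LinearMap.ker (polarMap s a)),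
    Nat.card_congr (polarMap s a).quotKerEquivRange.toEquiv, mul_comm]

/-- For fixed `a`, the number of pairs `(b, h)` for which `Tr (a x s(x)) + Tr (b x) + h` has
`n` zeros. -/
theorem card_zeroCount_eq (hp : p ≠ 2) (a : F) (n : ℕ) :
    ((Finset.univ.filter fun t : F × ZMod p => zeroCount s a t.1 t.2 = n).card : ℤ) =
      Nat.card (LinearMap.range (polarMap s a)) * levelCountFreq s a n +
        (Fintype.card F - Nat.card (LinearMap.range (polarMap s a))) *
          (if p * n = Fintype.card F then p else 0) := by
  classical
  have h1 : (Finset.univ.filter fun t : F × ZMod p => zeroCount s a t.1 t.2 = n).card =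
      ∑ b : F, (Finset.univ.filter fun h : ZMod p => zeroCount s a b h = n).card := by
    simp only [Finset.card_filter, ← Finset.univ_product_univ, Finset.sum_product]
  have h2 : ∀ b : F, (Finset.univ.filter fun h : ZMod p => zeroCount s a b h = n).card =
      if b ∈ LinearMap.range (polarMap s a) then levelCountFreq s a n
      else if p * n = Fintype.card F then p else 0 := by
    intro b
    split_ifs with hb hn
    · exact card_zeroCount_eq_of_mem_range s hb n
    · rw [Finset.filter_true_of_mem, Finset.card_univ, ZMod.card]
      intro h _
      have := zeroCount_of_notMem_range s hp hb h
      exact Nat.eq_of_mul_eq_mul_left (Fact.out : p.Prime).pos (this.trans hn.symm)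
    · rw [Finset.filter_false_of_mem, Finset.card_empty]
      rintro h _ rfl
      exact hn (zeroCount_of_notMem_range s hp hb h)
  have h3 : (Finset.univ.filter fun b => b ∈ LinearMap.range (polarMap s a)).card =
      Nat.card (LinearMap.range (polarMap s a)) := by
    rw [Nat.card_eq_fintype_card, Fintype.card_subtype]
  have h4 := Finset.card_filter_add_card_filter_not (s := (Finset.univ : Finset F))
    fun b => b ∈ LinearMap.range (polarMap s a)
  rw [h3, Finset.card_univ] at h4
  rw [h1, Finset.sum_congr rfl fun b _ => h2 b, Finset.sum_ite]
  simp only [Finset.sum_const, smul_eq_mul, h3, ← h4]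
  push_cast
  ring

theorem sum_levelCount (a : F) : ∑ c, levelCount s a c = Fintype.card F := by
  have := Finset.card_eq_sum_card_fiberwise (f := quadTrace s a) (s := Finset.univ)
    (t := Finset.univ) (fun _ _ => Finset.mem_coe.2 (Finset.mem_univ _))
  rw [Finset.card_univ] at this
  exact this.symm

theorem levelCount_mul_sq (a : F) {t : ZMod p} (ht : t ≠ 0) (c : ZMod p) :
    levelCount s a (c * t ^ 2) = levelCount s a c := by
  refine (Finset.card_equiv (Equiv.mulLeft₀ (algebraMap (ZMod p) F t) (by simpa using ht))
    fun x => ?_).symm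
  have : quadTrace s a (algebraMap (ZMod p) F t * x) = quadTrace s a x * t ^ 2 := by
    simp only [quadTrace, map_mul, AlgEquiv.commutes]
    rw [show a * (algebraMap (ZMod p) F t * x * (algebraMap (ZMod p) F t * s x)) =
      t ^ 2 • (a * (x * s x)) by rw [Algebra.smul_def, map_pow]; ring, map_smul, smul_eq_mul,
      mul_comm]
  simp only [Finset.mem_filter, Finset.mem_univ, true_and, Equiv.mulLeft₀_apply, this]
  exact (mul_left_inj' (pow_ne_zero 2 ht)).symm

/-- The second moment of the level counts. -/
theorem sum_levelCount_sq (hp : p ≠ 2) (a : F) :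
    (p : ℤ) * ∑ c, (levelCount s a c : ℤ) ^ 2 =
      (p - 1) * (Fintype.card F * Nat.card (LinearMap.ker (polarMap s a))) +
        (Fintype.card F : ℤ) ^ 2 := by
  classical
  have h2p : (2 : ZMod p) ≠ 0 := Ring.two_ne_zero (by rwa [ZMod.ringChar_zmod_n])
  have h2 : (2 : F) ≠ 0 := by
    rw [← map_ofNat (algebraMap (ZMod p) F) 2]
    exact (map_ne_zero (algebraMap (ZMod p) F)).2 h2p
  have e1 : ∑ c, (levelCount s a c) ^ 2 =
      (Finset.univ.filter fun t : F × F => quadTrace s a t.1 = quadTrace s a t.2).card := by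
    have := Finset.card_eq_sum_card_fiberwise (f := fun t : F × F => quadTrace s a t.1)
      (s := Finset.univ.filter fun t : F × F => quadTrace s a t.1 = quadTrace s a t.2)
      (t := Finset.univ) (fun _ _ => Finset.mem_coe.2 (Finset.mem_univ _))
    rw [this]
    refine Finset.sum_congr rfl fun c _ => ?_
    rw [sq, levelCount, ← Finset.card_product]
    congr 1
    ext t
    simp only [Finset.mem_product, Finset.mem_filter, Finset.mem_univ, true_and]
    constructor
    · rintro ⟨h, h'⟩
      exact ⟨h.trans h'.symm, h⟩
    · rintro ⟨h, h'⟩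
      exact ⟨h', h ▸ h'⟩
  -- In the coordinates `(y + x, y - x)` the difference of the two values is twice the polar form at
  -- `(x, y)`.
  have e2 : (Finset.univ.filter fun t : F × F => quadTrace s a t.1 = quadTrace s a t.2).card =
      (Finset.univ.filter fun t : F × F =>
        Algebra.trace (ZMod p) F (polarMap s a t.1 * t.2) = 0).card := by
    symm
    let e : F × F ≃ F × F :=
      { toFun := fun t => (t.2 + t.1, t.2 - t.1)
        invFun := fun t => ((t.1 - t.2) / 2, (t.1 + t.2) / 2)
        left_inv := fun t => by ext <;> simp <;> field_simp <;> ring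
        right_inv := fun t => by ext <;> simp <;> field_simp <;> ring }
    refine Finset.card_equiv e fun t => ?_
    have hneg : quadTrace s a (-t.1) = quadTrace s a t.1 := by simp [quadTrace]
    simp only [Finset.mem_filter, Finset.mem_univ, true_and, e, Equiv.coe_fn_mk]
    rw [sub_eq_add_neg, quadTrace_add, quadTrace_add, hneg, map_neg, neg_mul, map_neg]
    constructor
    · intro h
      rw [h, neg_zero]
    · intro h
      refine (mul_eq_zero.1 (?_ : (2 : ZMod p) * _ = 0)).resolve_left h2p
      linear_combination h
  -- An `x` in the radical pairs to zero with all of `F`, any other `x` with a hyperplane.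
  have e3 : p * (Finset.univ.filter fun t : F × F =>
        Algebra.trace (ZMod p) F (polarMap s a t.1 * t.2) = 0).card =
      ∑ x : F, if x ∈ LinearMap.ker (polarMap s a) then p * Fintype.card F
        else Fintype.card F := by
    have : (Finset.univ.filter fun t : F × F =>
        Algebra.trace (ZMod p) F (polarMap s a t.1 * t.2) = 0).card =
        ∑ x : F, (Finset.univ.filter fun y : F =>
          Algebra.trace (ZMod p) F (polarMap s a x * y) = 0).card := by
      simp only [Finset.card_filter, ← Finset.univ_product_univ, Finset.sum_product]
    rw [this, Finset.mul_sum]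
    refine Finset.sum_congr rfl fun x _ => ?_
    split_ifs with hx
    · rw [LinearMap.mem_ker] at hx
      simp [hx]
    · exact card_trace_mul_eq hx 0
  have h3 : (Finset.univ.filter fun b => b ∈ LinearMap.ker (polarMap s a)).card =
      Nat.card (LinearMap.ker (polarMap s a)) := by
    rw [Nat.card_eq_fintype_card, Fintype.card_subtype]
  have h4 := Finset.card_filter_add_card_filter_not (s := (Finset.univ : Finset F))
    fun b => b ∈ LinearMap.ker (polarMap s a)
  rw [h3, Finset.card_univ] at h4
  rw [Finset.sum_ite] at e3
  simp only [Finset.sum_const, smul_eq_mul, h3] at e3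
  have e4 : p * ∑ c, (levelCount s a c) ^ 2 =
      Nat.card (LinearMap.ker (polarMap s a)) * (p * Fintype.card F) +
      (Finset.univ.filter fun b => b ∉ LinearMap.ker (polarMap s a)).card * Fintype.card F := by
    rw [e1, e2, e3]
  have h4' := congrArg (Nat.cast : ℕ → ℤ) h4
  have e4' := congrArg (Nat.cast : ℕ → ℤ) e4
  push_cast at h4' e4'
  rw [e4']
  linear_combination (Fintype.card F : ℤ) * h4'

end QuadraticTraceForms

/-! ### The radical of the form, and fixed and negated elements of powers of Frobenius. -/

section PolarKernel

variable {p : ℕ} [Fact p.Prime] {F : Type*} [Field F] [Fintype F] [Algebra (ZMod p) F]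

theorem two_ne_zero_of_algebra_zmod (hp : p ≠ 2) : (2 : F) ≠ 0 := by
  rw [← map_ofNat (algebraMap (ZMod p) F) 2]
  exact (map_ne_zero (algebraMap (ZMod p) F)).2
    (Ring.two_ne_zero (by rwa [ZMod.ringChar_zmod_n]))

variable (s : F ≃ₐ[ZMod p] F)

theorem polarMap_eq_zero_iff (a x : F) : polarMap s a x = 0 ↔ s a * s (s x) = -(a * x) := by
  rw [polarMap_apply, ← s.injective.eq_iff, map_add, map_mul, AlgEquiv.apply_symm_apply, map_zero,
    eq_neg_iff_add_eq_zero]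

/-- Multiplying the kernel equation by `s x` turns it into a condition on the single element `a x
s(x)`: the radical is governed by the elements that `s` negates. -/
theorem polarMap_eq_zero_iff_of_ne_zero {x : F} (hx : x ≠ 0) (a : F) :
    polarMap s a x = 0 ↔ s (a * (x * s x)) = -(a * (x * s x)) := by
  have hs : s x ≠ 0 := by simpa using hx
  rw [polarMap_eq_zero_iff, map_mul, map_mul, ← mul_right_inj' hs]
  constructor <;> intro h <;> linear_combination h

/-- The power `x ↦ x ^ (p ^ l)` of the Frobenius automorphism. -/
noncomputable def frobPow (p : ℕ) [Fact p.Prime] (F : Type*) [Field F] [Fintype F]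
    [Algebra (ZMod p) F] (l : ℕ) : F ≃ₐ[ZMod p] F :=
  FiniteField.frobeniusAlgEquivOfAlgebraic (ZMod p) F ^ l

theorem frobPow_apply (l : ℕ) (x : F) : frobPow p F l x = x ^ p ^ l := by
  rw [frobPow, AlgEquiv.coe_pow, FiniteField.coe_frobeniusAlgEquivOfAlgebraic_iterate, ZMod.card]

theorem frobPow_iterate (l : ℕ) (x : F) : frobPow p F l (frobPow p F l x) = frobPow p F (2 * l) x := by
  rw [frobPow_apply, frobPow_apply, frobPow_apply, ← pow_mul, ← pow_add, two_mul]

theorem exists_algebraMap_eq_of_pow_eq {x : F} (h : x ^ p = x) :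
    ∃ c : ZMod p, algebraMap (ZMod p) F c = x := by
  have : CharP F p := charP_of_injective_algebraMap (algebraMap (ZMod p) F).injective p
  have := (Subfield.mem_bot_iff_pow_eq_self (F := F) (p := p)).2 h
  rw [← ZMod.fieldRange_castHom_eq_bot p] at this
  obtain ⟨c, hc⟩ := this
  exact ⟨c, by rw [← hc]; exact DFunLike.congr_fun (Subsingleton.elim _ _) c⟩

/-- Under `y ↦ y ^ p` the element `x` has both periods `m` and `l`, hence period `gcd(m, l) = 1`. -/
theorem exists_algebraMap_eq_of_frobPow_eq {m l : ℕ} (hF : Fintype.card F = p ^ m)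
    (hml : Nat.Coprime m l) {x : F} (h : frobPow p F l x = x) :
    ∃ c : ZMod p, algebraMap (ZMod p) F c = x := by
  have key : ∀ k : ℕ, Function.IsPeriodicPt (fun y : F => y ^ p) k x ↔ x ^ p ^ k = x := by
    intro k
    rw [Function.IsPeriodicPt, pow_iterate]
    rfl
  have h1 := ((key m).2 (by rw [← hF, FiniteField.pow_card])).gcd
    ((key l).2 (by rw [← frobPow_apply, h]))
  rw [hml.gcd_eq_one, key, pow_one] at h1
  exact exists_algebraMap_eq_of_pow_eq h1

/-- The `m`-th iterate of `frobPow p F l` is the identity, yet it multiplies `z` by `(-1)^m = -1`.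
-/
theorem eq_zero_of_frobPow_eq_neg (hp : p ≠ 2) {m l : ℕ} (hF : Fintype.card F = p ^ m)
    (hm : Odd m) {z : F} (h : frobPow p F l z = -z) : z = 0 := by
  have key : ∀ j : ℕ, z ^ (p ^ l) ^ j = (-1) ^ j * z := by
    intro j
    induction j with
    | zero => simp
    | succ j ih =>
      rw [pow_succ, pow_mul, ih, ← frobPow_apply, map_mul, h, map_pow, map_neg, map_one]
      ring
  have h1 := key m
  rw [hm.neg_one_pow, ← pow_mul, mul_comm, pow_mul, ← hF, FiniteField.pow_card_pow] at h1
  refine (mul_eq_zero.1 (?_ : (2 : F) * z = 0)).resolve_left (two_ne_zero_of_algebra_zmod (p := p) hp)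
  linear_combination h1

end PolarKernel

/-! ### Odd `m`: nondegeneracy, and the pairing of levels by a nonsquare. -/

section OddDegree

variable {p : ℕ} [Fact p.Prime] {F : Type*} [Field F] [Fintype F] [Algebra (ZMod p) F]
  {m l : ℕ}

theorem card_ker_polarMap_of_odd (hp : p ≠ 2) (hF : Fintype.card F = p ^ m) (hm : Odd m) {a : F}
    (ha : a ≠ 0) : Nat.card (LinearMap.ker (polarMap (frobPow p F l) a)) = 1 := by
  have : LinearMap.ker (polarMap (frobPow p F l) a) = ⊥ := by
    rw [LinearMap.ker_eq_bot']
    intro x hx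
    by_contra hx0
    rw [polarMap_eq_zero_iff_of_ne_zero _ hx0] at hx
    have := eq_zero_of_frobPow_eq_neg hp hF hm hx
    simp [ha, hx0] at this
  rw [this]
  simp

/-- By Euler's criterion a square root `w` of a nonsquare would satisfy `w^p = -w`, which forces `w
= 0` in odd degree. -/
theorem not_isSquare_algebraMap_of_odd (hp : p ≠ 2) (hF : Fintype.card F = p ^ m) (hm : Odd m)
    {u : ZMod p} (hu : ¬ IsSquare u) : ¬ IsSquare (algebraMap (ZMod p) F u) := by
  have hu0 : u ≠ 0 := by
    rintro rfl
    exact hu (IsSquare.zero)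
  rintro ⟨w, hw⟩
  have hchar : ringChar (ZMod p) ≠ 2 := by rwa [ZMod.ringChar_zmod_n]
  have h1 : u ^ (p / 2) = -1 := by
    have := (FiniteField.isSquare_iff hchar hu0).not.1 hu
    rw [ZMod.card] at this
    have h2 := FiniteField.pow_dichotomy hchar hu0
    rw [ZMod.card] at h2
    exact h2.resolve_left this
  have hodd : p = 2 * (p / 2) + 1 := by
    have := (Fact.out : p.Prime).eq_two_or_odd
    omega
  have h2 : w ^ p = -w := by
    rw [hodd, pow_succ, pow_mul, sq, ← hw, ← map_pow, h1]
    simp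
  have h3 : w = 0 := eq_zero_of_frobPow_eq_neg (p := p) (l := 1) hp hF hm
    (by rw [frobPow_apply, pow_one, h2])
  rw [h3, mul_zero] at hw
  exact hu0 (by simpa using hw)

/-- The ratio `w` of two solutions satisfies `w s(w) = 1`, so `s^2` fixes it. Since `m` is coprime
to `2l`, `w` lies in `𝔽_p`, where `w s(w) = w^2`; hence `w = ±1`. -/
theorem card_mul_frobPow_eq_le [DecidableEq F] (hF : Fintype.card F = p ^ m)
    (hml : Nat.Coprime m l) (hm : Odd m) {c : F} (hc : c ≠ 0) (y : F) :
    (Finset.univ.filter fun x : F => c * (x * frobPow p F l x) = y).card ≤ 2 := by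
  by_cases hne : ∃ x₀, c * (x₀ * frobPow p F l x₀) = y
  · obtain ⟨x₀, rfl⟩ := hne
    refine (Finset.card_le_card (t := {x₀, -x₀}) fun x hx => ?_).trans Finset.card_le_two
    simp only [Finset.mem_filter, Finset.mem_univ, true_and, mul_right_inj' hc] at hx
    simp only [Finset.mem_insert, Finset.mem_singleton]
    by_cases hx₀ : x₀ = 0
    · subst hx₀
      simpa using hx
    have hs : frobPow p F l x₀ ≠ 0 := by simpa using hx₀
    have hw : x / x₀ * frobPow p F l (x / x₀) = 1 := by
      rw [map_div₀]
      field_simp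
      exact hx
    have hw0 : x / x₀ ≠ 0 := left_ne_zero_of_mul_eq_one hw
    have hfix : frobPow p F (2 * l) (x / x₀) = x / x₀ := by
      rw [← frobPow_iterate]
      have h1 : frobPow p F l (x / x₀) = (x / x₀)⁻¹ := eq_inv_of_mul_eq_one_right hw
      rw [h1, map_inv₀, h1, inv_inv]
    have hco : Nat.Coprime m (2 * l) :=
      Nat.Coprime.mul_right (Nat.coprime_two_right.2 hm) hml
    obtain ⟨w, hw'⟩ := exists_algebraMap_eq_of_frobPow_eq hF hco hfix
    rw [← hw', AlgEquiv.commutes, hw', mul_self_eq_one_iff] at hw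
    rcases hw with h | h
    · exact Or.inl (by rwa [div_eq_one_iff_eq hx₀] at h)
    · exact Or.inr (by rw [div_eq_iff hx₀] at h; simpa using h)
  · rw [Finset.filter_false_of_mem fun x _ h => hne ⟨x, h⟩]
    simp

/-- Multiplication by a nonsquare `u` turns the values of `x ↦ x ^ (p ^ l + 1)` into the missing
ones. -/
theorem card_mul_frobPow_eq_add [DecidableEq F] (hp : p ≠ 2) (hF : Fintype.card F = p ^ m)
    (hml : Nat.Coprime m l) (hm : Odd m) {u : ZMod p} (hu : ¬ IsSquare u) (y : F) :
    (Finset.univ.filter fun x : F => x * frobPow p F l x = y).card +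
      (Finset.univ.filter fun x : F =>
        algebraMap (ZMod p) F u * (x * frobPow p F l x) = y).card = 2 := by
  have hu0 : algebraMap (ZMod p) F u ≠ 0 := by
    rw [_root_.map_ne_zero]
    rintro rfl
    exact hu IsSquare.zero
  have hle : ∀ y : F, (Finset.univ.filter fun x : F => x * frobPow p F l x = y).card +
      (Finset.univ.filter fun x : F =>
        algebraMap (ZMod p) F u * (x * frobPow p F l x) = y).card ≤ 2 := by
    intro y
    by_cases hy : y = 0
    · subst hy
      have h1 : (Finset.univ.filter fun x : F => x * frobPow p F l x = 0) = {0} := by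
        ext x; simp
      have h2 : (Finset.univ.filter fun x : F =>
        algebraMap (ZMod p) F u * (x * frobPow p F l x) = 0) = {0} := by
        ext x; simp [hu0]
      rw [h1, h2]
      simp
    have h1 := card_mul_frobPow_eq_le (p := p) hF hml hm one_ne_zero y
    have h2 := card_mul_frobPow_eq_le (p := p) hF hml hm hu0 y
    simp only [one_mul] at h1
    by_cases hx : ∃ x, x * frobPow p F l x = y
    · obtain ⟨x, hx⟩ := hx
      suffices h : (Finset.univ.filter fun x : F =>
          algebraMap (ZMod p) F u * (x * frobPow p F l x) = y) = ∅ by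
        rw [h]
        simpa using h1
      -- If both maps hit `y ≠ 0`, then `u` is a `(p^l + 1)`-th power with even exponent, hence a
      -- square.
      refine Finset.filter_false_of_mem fun x' _ hx' => ?_
      refine not_isSquare_algebraMap_of_odd hp hF hm hu ?_
      have hx'0 : x' ≠ 0 := by
        rintro rfl
        exact hy (by rw [← hx']; simp)
      have hx'1 : frobPow p F l x' ≠ 0 := by simpa using hx'0
      have : algebraMap (ZMod p) F u = (x / x') ^ (p ^ l + 1) := by
        rw [pow_succ', ← frobPow_apply, map_div₀]
        field_simp
        rw [hx, ← hx']
        ring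
      rw [this]
      exact Even.isSquare_pow
        (((Fact.out : p.Prime).odd_of_ne_two hp).pow.add_odd odd_one) _
    · rw [Finset.filter_false_of_mem fun x _ h => hx ⟨x, h⟩]
      simpa using h2
  -- Each count is at most `2` and the total is `2q`, so equality holds everywhere.
  have hsum : ∑ y : F, ((Finset.univ.filter fun x : F => x * frobPow p F l x = y).card +
      (Finset.univ.filter fun x : F =>
        algebraMap (ZMod p) F u * (x * frobPow p F l x) = y).card) = ∑ _y : F, 2 := by
    rw [Finset.sum_add_distrib, ← Finset.card_eq_sum_card_fiberwise
      (fun _ _ => Finset.mem_coe.2 (Finset.mem_univ _)), ← Finset.card_eq_sum_card_fiberwise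
      (fun _ _ => Finset.mem_coe.2 (Finset.mem_univ _))]
    simp
    ring
  exact (Finset.sum_eq_sum_iff_of_le fun y _ => hle y).1 hsum y (Finset.mem_univ y)

/-- Together the maps `x ↦ x s(x)` and `x ↦ u x s(x)` cover each element twice, in particular each
of the `q/p` elements `y` with `Tr(ay) = uc`. The preimages under the second map form the level `c`.
-/
theorem levelCount_add_levelCount (hp : p ≠ 2) (hF : Fintype.card F = p ^ m)
    (hml : Nat.Coprime m l) (hm : Odd m) {u : ZMod p} (hu : ¬ IsSquare u) {a : F} (ha : a ≠ 0)
    (c : ZMod p) :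
    p * (levelCount (frobPow p F l) a (u * c) + levelCount (frobPow p F l) a c) =
      2 * Fintype.card F := by
  classical
  have hu0 : u ≠ 0 := by
    rintro rfl
    exact hu IsSquare.zero
  set S := Finset.univ.filter fun y : F => Algebra.trace (ZMod p) F (a * y) = u * c with hS
  have h1 : levelCount (frobPow p F l) a (u * c) =
      ∑ y ∈ S, (Finset.univ.filter fun x : F => x * frobPow p F l x = y).card := by
    rw [levelCount, Finset.card_eq_sum_card_fiberwise (f := fun x : F => x * frobPow p F l x)
      (t := S) (fun x hx => by
        have := (Finset.mem_filter.1 (Finset.mem_coe.1 hx)).2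
        simpa [hS, quadTrace] using this)]
    refine Finset.sum_congr rfl fun y hy => ?_
    congr 1
    ext x
    simp only [hS, Finset.mem_filter, Finset.mem_univ, true_and] at hy
    simp only [Finset.mem_filter, Finset.mem_univ, true_and, and_iff_right_iff_imp]
    rintro rfl
    exact hy
  have h2 : levelCount (frobPow p F l) a c = ∑ y ∈ S, (Finset.univ.filter fun x : F =>
        algebraMap (ZMod p) F u * (x * frobPow p F l x) = y).card := by
    have key : ∀ x : F, Algebra.trace (ZMod p) F
        (a * (algebraMap (ZMod p) F u * (x * frobPow p F l x))) =
        u * quadTrace (frobPow p F l) a x := by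
      intro x
      rw [quadTrace, ← smul_eq_mul u, ← map_smul, Algebra.smul_def]
      congr 1
      ring
    rw [levelCount, Finset.card_eq_sum_card_fiberwise
      (f := fun x : F => algebraMap (ZMod p) F u * (x * frobPow p F l x))
      (t := S) (fun x hx => by
        have := (Finset.mem_filter.1 (Finset.mem_coe.1 hx)).2
        simp [hS, key, this])]
    refine Finset.sum_congr rfl fun y hy => ?_
    congr 1
    ext x
    simp only [hS, Finset.mem_filter, Finset.mem_univ, true_and] at hy
    simp only [Finset.mem_filter, Finset.mem_univ, true_and, and_iff_right_iff_imp]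
    rintro rfl
    rw [key, mul_right_inj' hu0] at hy
    exact hy
  rw [h1, h2, ← Finset.sum_add_distrib,
    Finset.sum_congr rfl fun y _ => card_mul_frobPow_eq_add hp hF hml hm hu y,
    Finset.sum_const, smul_eq_mul, ← card_trace_mul_eq ha (u * c)]
  ring

end OddDegree

/-! ### Odd `m`: sizes and multiplicities of the level sets. -/

section LevelCountsOdd

variable {p : ℕ} [Fact p.Prime] {F : Type*} [Field F] [Fintype F] [Algebra (ZMod p) F]
  {m l : ℕ}

theorem exists_eq_mul_sq_of_not_isSquare {u c : ZMod p} (hu : ¬ IsSquare u)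
    (hc : ¬ IsSquare c) : ∃ t, t ≠ 0 ∧ c = u * t ^ 2 := by
  have hu0 : u ≠ 0 := by
    rintro rfl
    exact hu IsSquare.zero
  have hc0 : c ≠ 0 := by
    rintro rfl
    exact hc IsSquare.zero
  have h1 : IsSquare (u * c) := by
    rw [← quadraticChar_one_iff_isSquare (mul_ne_zero hu0 hc0), map_mul,
      quadraticChar_neg_one_iff_not_isSquare.2 hu, quadraticChar_neg_one_iff_not_isSquare.2 hc]
    norm_num
  obtain ⟨t, ht⟩ := h1
  have ht0 : t ≠ 0 := by
    rintro rfl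
    exact mul_ne_zero hu0 hc0 (by simpa using ht)
  refine ⟨t / u, div_ne_zero ht0 hu0, ?_⟩
  field_simp
  linear_combination ht

/-- The nonsquare pairing matches the level `0` with itself. -/
theorem levelCount_zero_of_odd (hp : p ≠ 2) (hF : Fintype.card F = p ^ m)
    (hml : Nat.Coprime m l) (hm : Odd m) {a : F} (ha : a ≠ 0) :
    levelCount (frobPow p F l) a 0 = p ^ (m - 1) := by
  obtain ⟨u, hu⟩ := FiniteField.exists_nonsquare (F := ZMod p) (by rwa [ZMod.ringChar_zmod_n])
  have h := levelCount_add_levelCount hp hF hml hm hu ha 0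
  rw [mul_zero, ← two_mul, hF, ← pow_sub_one_mul hm.pos.ne' p] at h
  refine Nat.eq_of_mul_eq_mul_left (Nat.mul_pos (Fact.out : p.Prime).pos two_pos) ?_
  linarith

theorem levelCount_mul_nonsquare (hp : p ≠ 2) (hF : Fintype.card F = p ^ m)
    (hml : Nat.Coprime m l) (hm : Odd m) {a : F} (ha : a ≠ 0) {u : ZMod p} (hu : ¬ IsSquare u)
    (c : ZMod p) :
    (levelCount (frobPow p F l) a (u * c) : ℤ) - p ^ (m - 1) =
      -(levelCount (frobPow p F l) a c - p ^ (m - 1)) := by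
  have h := congrArg (Nat.cast : ℕ → ℤ) (levelCount_add_levelCount hp hF hml hm hu ha c)
  rw [hF, ← pow_sub_one_mul hm.pos.ne' p] at h
  push_cast at h
  refine mul_left_cancel₀ (Nat.cast_ne_zero.2 (Fact.out : p.Prime).ne_zero : (p : ℤ) ≠ 0) ?_
  linear_combination h

/-- The deviation `D c` from `q/p` vanishes at `0`; scaling `c` by a square preserves it and by a
nonsquare negates it. So `D c ^ 2` is constant off `0`, and the second moment with trivial radical
evaluates it. -/
theorem levelCount_sub_sq_of_odd (hp : p ≠ 2) (hF : Fintype.card F = p ^ m)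
    (hml : Nat.Coprime m l) (hm : Odd m) {a : F} (ha : a ≠ 0) {c : ZMod p} (hc : c ≠ 0) :
    ((levelCount (frobPow p F l) a c : ℤ) - p ^ (m - 1)) ^ 2 = p ^ (m - 1) := by
  obtain ⟨u, hu⟩ := FiniteField.exists_nonsquare (F := ZMod p) (by rwa [ZMod.ringChar_zmod_n])
  set D : ZMod p → ℤ := fun c => (levelCount (frobPow p F l) a c : ℤ) - p ^ (m - 1) with hD
  have hp0 : (p : ℤ) ≠ 0 := Nat.cast_ne_zero.2 (Fact.out : p.Prime).ne_zero
  have hp1 : (p : ℤ) - 1 ≠ 0 := by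
    have := (Fact.out : p.Prime).one_lt
    omega
  have hq : (Fintype.card F : ℤ) = p * p ^ (m - 1) := by
    rw [hF, ← Nat.sub_add_cancel hm.pos, pow_succ']
    simp
  have hD0 : D 0 = 0 := by simp [hD, levelCount_zero_of_odd hp hF hml hm ha]
  have hconst : ∀ c, c ≠ 0 → D c ^ 2 = D 1 ^ 2 := by
    intro c hc
    by_cases hsq : IsSquare c
    · obtain ⟨t, rfl⟩ := hsq
      have ht : t ≠ 0 := left_ne_zero_of_mul hc
      have := levelCount_mul_sq (frobPow p F l) a ht 1
      rw [one_mul, sq] at this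
      simp only [hD, this]
    · obtain ⟨t, ht, rfl⟩ := exists_eq_mul_sq_of_not_isSquare hu hsq
      have h1 := levelCount_mul_nonsquare hp hF hml hm ha hu (1 * t ^ 2)
      rw [levelCount_mul_sq (frobPow p F l) a ht 1, one_mul] at h1
      simp only [hD, h1]
      ring
  have hsum : ∑ c, D c = 0 := by
    have h := congrArg (Nat.cast : ℕ → ℤ) (sum_levelCount (frobPow p F l) a)
    push_cast at h
    simp only [hD, Finset.sum_sub_distrib, h, Finset.sum_const, Finset.card_univ, ZMod.card, hq]
    simp
  have hsq := sum_levelCount_sq (frobPow p F l) hp a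
  rw [card_ker_polarMap_of_odd hp hF hm ha, hq] at hsq
  have h2 : ∑ c, (levelCount (frobPow p F l) a c : ℤ) ^ 2 =
      ∑ c, D c ^ 2 + p * (p ^ (m - 1)) ^ 2 := by
    have : ∀ c, (levelCount (frobPow p F l) a c : ℤ) ^ 2 =
        D c ^ 2 + 2 * p ^ (m - 1) * D c + (p ^ (m - 1)) ^ 2 := by
      intro c
      simp only [hD]
      ring
    rw [Finset.sum_congr rfl fun c _ => this c, Finset.sum_add_distrib, Finset.sum_add_distrib,
      ← Finset.mul_sum, hsum]
    simp [ZMod.card]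
  have h3 : ∑ c, D c ^ 2 = (p - 1) * D 1 ^ 2 := by
    classical
    rw [← Finset.add_sum_erase _ _ (Finset.mem_univ (0 : ZMod p)), hD0,
      Finset.sum_congr rfl fun c hc => hconst c (Finset.ne_of_mem_erase hc), Finset.sum_const,
      Finset.card_erase_of_mem (Finset.mem_univ _), Finset.card_univ, ZMod.card, nsmul_eq_mul,
      Nat.cast_sub (Fact.out : p.Prime).one_le]
    simp
  rw [h2, h3] at hsq
  change D c ^ 2 = _
  rw [hconst c hc]
  refine mul_left_cancel₀ hp0 (mul_left_cancel₀ hp1 ?_)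
  push_cast at hsq
  linear_combination hsq

/-- The level counts for odd `m`. -/
theorem levelCount_of_odd (hp : p ≠ 2) (hF : Fintype.card F = p ^ m)
    (hml : Nat.Coprime m l) (hm : Odd m) {a : F} (ha : a ≠ 0) {c : ZMod p} (hc : c ≠ 0) :
    (levelCount (frobPow p F l) a c : ℤ) = p ^ (m - 1) + p ^ ((m - 1) / 2) ∨
      (levelCount (frobPow p F l) a c : ℤ) = p ^ (m - 1) - p ^ ((m - 1) / 2) := by
  have h := levelCount_sub_sq_of_odd hp hF hml hm ha hc
  have h2 : (p : ℤ) ^ (m - 1) = (p ^ ((m - 1) / 2)) ^ 2 := by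
    obtain ⟨k, rfl⟩ := hm
    rw [← pow_mul]
    congr 1
    omega
  rw [h2, sq_eq_sq_iff_eq_or_eq_neg, ← h2] at h
  rcases h with h | h
  · left
    linear_combination h
  · right
    linear_combination h

theorem levelCountFreq_center_of_odd (hp : p ≠ 2) (hF : Fintype.card F = p ^ m)
    (hml : Nat.Coprime m l) (hm : Odd m) {a : F} (ha : a ≠ 0) :
    levelCountFreq (frobPow p F l) a (p ^ (m - 1)) = 1 := by
  rw [levelCountFreq, Finset.card_eq_one]
  refine ⟨0, ?_⟩
  ext c
  simp only [Finset.mem_filter, Finset.mem_univ, true_and, Finset.mem_singleton]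
  constructor
  · intro h
    by_contra hc
    have := levelCount_sub_sq_of_odd hp hF hml hm ha hc
    rw [h] at this
    have h0 : (p : ℤ) ^ (m - 1) ≠ 0 :=
      pow_ne_zero _ (Nat.cast_ne_zero.2 (Fact.out : p.Prime).ne_zero)
    push_cast at this
    exact h0 (by rw [← this]; ring)
  · rintro rfl
    exact levelCount_zero_of_odd hp hF hml hm ha

theorem levelCountFreq_of_odd (hp : p ≠ 2) (hF : Fintype.card F = p ^ m)
    (hml : Nat.Coprime m l) (hm : Odd m) {a : F} (ha : a ≠ 0) {n : ℕ}
    (hn : (n : ℤ) = p ^ (m - 1) + p ^ ((m - 1) / 2) ∨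
      (n : ℤ) = p ^ (m - 1) - p ^ ((m - 1) / 2)) :
    2 * (levelCountFreq (frobPow p F l) a n : ℤ) = p - 1 := by
  classical
  obtain ⟨u, hu⟩ := FiniteField.exists_nonsquare (F := ZMod p) (by rwa [ZMod.ringChar_zmod_n])
  have hu0 : u ≠ 0 := by
    rintro rfl
    exact hu IsSquare.zero
  have hs0 : (p : ℤ) ^ ((m - 1) / 2) ≠ 0 :=
      pow_ne_zero _ (Nat.cast_ne_zero.2 (Fact.out : p.Prime).ne_zero)
  set s : ℤ := p ^ ((m - 1) / 2) with hs
  set A := Finset.univ.filter fun c : ZMod p => levelCount (frobPow p F l) a c = n with hA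
  set B := (Finset.univ.erase (0 : ZMod p)) \ A with hB
  have h0 := levelCount_zero_of_odd hp hF hml hm ha
  have h0A : (0 : ZMod p) ∉ A := by
    intro h
    have h' := (Finset.mem_filter.1 h).2
    rw [h0] at h'
    rw [← h'] at hn
    push_cast at hn
    rcases hn with h | h
    · exact hs0 (by linear_combination -h)
    · exact hs0 (by linear_combination h)
  have hAsub : A ⊆ Finset.univ.erase 0 := fun c hc =>
    Finset.mem_erase.2 ⟨fun h => h0A (h ▸ hc), Finset.mem_univ _⟩
  -- Multiplication by `u` negates the deviation, so it exchanges the two possible values on the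
  -- nonzero levels.
  have hAB : A.card = B.card := by
    refine Finset.card_equiv (Equiv.mulLeft₀ u hu0) fun c => ?_
    have hneg := levelCount_mul_nonsquare hp hF hml hm ha hu c
    simp only [hA, hB, Finset.mem_sdiff, Finset.mem_erase, Finset.mem_filter, Finset.mem_univ,
      true_and, and_true, Equiv.mulLeft₀_apply, mul_ne_zero_iff, hu0, ne_eq, not_false_eq_true]
    by_cases hc : c = 0
    · subst hc
      simp only [not_true_eq_false, false_and, iff_false]
      intro h
      exact h0A (Finset.mem_filter.2 ⟨Finset.mem_univ _, h⟩)
    have hval := levelCount_of_odd hp hF hml hm ha hc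
    rw [← hs] at hval
    simp only [hc, not_false_eq_true, true_and]
    zify
    constructor
    · intro h h'
      rw [h, h'] at hneg
      rcases hn with h | h
      · exact hs0 (by linarith)
      · exact hs0 (by linarith)
    · intro h
      rcases hn with hn | hn <;> rcases hval with hval | hval
      · rw [hn, hval]
      · exact absurd (by rw [hn]; linear_combination hneg - hval) h
      · exact absurd (by rw [hn]; linear_combination hneg - hval) h
      · rw [hn, hval]
  have hcard := Finset.card_sdiff_add_card_eq_card hAsub
  rw [Finset.card_erase_of_mem (Finset.mem_univ _), Finset.card_univ, ZMod.card, ← hB,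
    ← hAB] at hcard
  have : 2 * A.card = p - 1 := by omega
  have h2 := (Fact.out : p.Prime).one_le
  rw [levelCountFreq]
  zify [h2] at this
  exact this

end LevelCountsOdd

/-! ### Consequences of a nonzero `z₀` with `s z₀ = -z₀`: norms, radicals, and the number of
degenerate forms. -/

section SkewElement

variable {p : ℕ} [Fact p.Prime] {F : Type*} [Field F] [Fintype F] [Algebra (ZMod p) F]
  (s : F ≃ₐ[ZMod p] F)

theorem exists_algebraMap_mul_of_apply_eq_neg
    (hfix : ∀ x, s x = x → ∃ c : ZMod p, algebraMap (ZMod p) F c = x) {z₀ : F} (hz₀ : z₀ ≠ 0)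
    (hz : s z₀ = -z₀) {z : F} : s z = -z ↔ ∃ c : ZMod p, algebraMap (ZMod p) F c * z₀ = z := by
  constructor
  · intro h
    obtain ⟨c, hc⟩ := hfix (z / z₀) (by rw [map_div₀, h, hz, neg_div_neg_eq])
    exact ⟨c, by rw [hc, div_mul_cancel₀ _ hz₀]⟩
  · rintro ⟨c, rfl⟩
    rw [map_mul, AlgEquiv.commutes, hz, mul_neg]

/-- Split `y` into its `s`-even and `s`-odd halves: the first lies in `𝔽_p`, the second in `𝔽_p z₀`.
With `pair_injective` this shows that `s^2` has exactly `p^2` fixed points. -/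
theorem apply_apply_eq_iff (hp : p ≠ 2)
    (hfix : ∀ x, s x = x → ∃ c : ZMod p, algebraMap (ZMod p) F c = x) {z₀ : F} (hz₀ : z₀ ≠ 0)
    (hz : s z₀ = -z₀) {y : F} :
    s (s y) = y ↔ ∃ t : ZMod p × ZMod p,
      algebraMap (ZMod p) F t.1 + algebraMap (ZMod p) F t.2 * z₀ = y := by
  have h2 : (2 : F) ≠ 0 := two_ne_zero_of_algebra_zmod (p := p) hp
  constructor
  · intro h
    obtain ⟨c, hc⟩ := hfix ((y + s y) / 2) (by
      rw [map_div₀, map_add, h, map_ofNat, add_comm])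
    obtain ⟨d, hd⟩ := (exists_algebraMap_mul_of_apply_eq_neg s hfix hz₀ hz (z := (y - s y) / 2)).1
      (by rw [map_div₀, map_sub, h, map_ofNat]; ring)
    refine ⟨(c, d), ?_⟩
    simp only [hc, hd]
    field_simp
    ring
  · rintro ⟨t, rfl⟩
    simp [hz]

theorem pair_injective (hp : p ≠ 2) {z₀ : F} (hz₀ : z₀ ≠ 0)
    (hz : s z₀ = -z₀) : Function.Injective fun t : ZMod p × ZMod p =>
      algebraMap (ZMod p) F t.1 + algebraMap (ZMod p) F t.2 * z₀ := by
  have h2 : (2 : F) ≠ 0 := two_ne_zero_of_algebra_zmod (p := p) hp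
  intro t t' h
  simp only at h
  have h' := congrArg s h
  simp only [map_add, map_mul, AlgEquiv.commutes, hz] at h'
  have e1 : algebraMap (ZMod p) F t.1 = algebraMap (ZMod p) F t'.1 :=
    mul_left_cancel₀ h2 (by linear_combination h + h')
  have e2 : algebraMap (ZMod p) F t.2 = algebraMap (ZMod p) F t'.2 :=
    mul_left_cancel₀ (mul_ne_zero h2 hz₀) (by linear_combination h - h')
  exact Prod.ext ((algebraMap (ZMod p) F).injective e1) ((algebraMap (ZMod p) F).injective e2)

/-- With `d = z₀^2 ∈ 𝔽_p`, the element `w = x + y z₀` has `w s(w) = x^2 - d y^2`, a binary form that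
represents every element of a finite field of odd order. -/
theorem exists_mul_apply_eq (hp : p ≠ 2)
    (hfix : ∀ x, s x = x → ∃ c : ZMod p, algebraMap (ZMod p) F c = x) {z₀ : F} (hz₀ : z₀ ≠ 0)
    (hz : s z₀ = -z₀) (u : ZMod p) : ∃ w : F, w * s w = algebraMap (ZMod p) F u := by
  obtain ⟨d, hd⟩ := hfix (z₀ ^ 2) (by rw [map_pow, hz, neg_sq])
  have hd0 : d ≠ 0 := by
    rintro rfl
    exact pow_ne_zero 2 hz₀ (by rw [← hd, map_zero])
  have hdeg : (C (-d) * X ^ 2 - C u : (ZMod p)[X]).degree = 2 := by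
    rw [sub_eq_add_neg, ← map_neg, degree_add_eq_left_of_degree_lt, degree_C_mul_X_pow _
      (neg_ne_zero.2 hd0)]
    · rfl
    · rw [degree_C_mul_X_pow _ (neg_ne_zero.2 hd0)]
      exact degree_C_le.trans_lt (by norm_num)
  obtain ⟨x, y, hxy⟩ := FiniteField.exists_root_sum_quadratic (degree_X_pow 2) hdeg (by
    rw [ZMod.card]
    exact (Fact.out : p.Prime).eq_two_or_odd.resolve_left hp)
  simp only [eval_pow, eval_X, eval_sub, eval_mul, eval_C] at hxy
  refine ⟨algebraMap (ZMod p) F x + algebraMap (ZMod p) F y * z₀, ?_⟩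
  have h := congrArg (algebraMap (ZMod p) F) hxy
  simp only [map_add, map_sub, map_mul, map_pow, map_neg, map_zero, hd] at h
  simp only [map_add, map_mul, AlgEquiv.commutes, hz]
  linear_combination h

/-- Multiplication by a `w` with `w s(w) = c` multiplies the quadratic form by `c`. -/
theorem levelCount_eq_levelCount_one (hp : p ≠ 2)
    (hfix : ∀ x, s x = x → ∃ c : ZMod p, algebraMap (ZMod p) F c = x) {z₀ : F} (hz₀ : z₀ ≠ 0)
    (hz : s z₀ = -z₀) (a : F) {c : ZMod p} (hc : c ≠ 0) :
    levelCount s a c = levelCount s a 1 := by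
  obtain ⟨w, hw⟩ := exists_mul_apply_eq s hp hfix hz₀ hz c
  have hw0 : w ≠ 0 := by
    rintro rfl
    rw [zero_mul] at hw
    exact hc (by simpa using hw.symm)
  refine (Finset.card_equiv (Equiv.mulLeft₀ w hw0) fun x => ?_).symm
  have : quadTrace s a (w * x) = c * quadTrace s a x := by
    rw [quadTrace, quadTrace, ← smul_eq_mul c, ← map_smul, Algebra.smul_def, ← hw, map_mul s]
    congr 1
    ring
  simp only [Finset.mem_filter, Finset.mem_univ, true_and, Equiv.mulLeft₀_apply, this]
  constructor
  · intro h
    rw [h, mul_one]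
  · intro h
    exact mul_left_cancel₀ hc (h.trans (mul_one c).symm)

/-- Dividing by one nonzero radical vector `x₀` identifies the radical with the fixed points of
`s^2`. -/
theorem card_ker_polarMap_of_exists (hp : p ≠ 2)
    (hfix : ∀ x, s x = x → ∃ c : ZMod p, algebraMap (ZMod p) F c = x) {z₀ : F} (hz₀ : z₀ ≠ 0)
    (hz : s z₀ = -z₀) {a x₀ : F} (ha : a ≠ 0) (hx₀ : x₀ ≠ 0) (h : polarMap s a x₀ = 0) :
    Nat.card (LinearMap.ker (polarMap s a)) = p ^ 2 := by
  rw [polarMap_eq_zero_iff] at h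
  have key : ∀ y, polarMap s a (x₀ * y) = 0 ↔ s (s y) = y := by
    intro y
    rw [polarMap_eq_zero_iff, map_mul, map_mul, ← mul_assoc, h,
      show -(a * (x₀ * y)) = -(a * x₀) * y by ring]
    exact mul_right_inj' (neg_ne_zero.2 (mul_ne_zero ha hx₀))
  let f : ZMod p × ZMod p → LinearMap.ker (polarMap s a) := fun t =>
    ⟨x₀ * (algebraMap (ZMod p) F t.1 + algebraMap (ZMod p) F t.2 * z₀), by
      rw [LinearMap.mem_ker, key]
      exact (apply_apply_eq_iff s hp hfix hz₀ hz).2 ⟨t, rfl⟩⟩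
  have hf : Function.Bijective f := by
    constructor
    · intro t t' htt
      exact pair_injective s hp hz₀ hz (mul_left_cancel₀ hx₀ (congrArg Subtype.val htt))
    · rintro ⟨x, hx⟩
      rw [LinearMap.mem_ker, ← mul_div_cancel₀ x hx₀, key] at hx
      obtain ⟨t, ht⟩ := (apply_apply_eq_iff s hp hfix hz₀ hz).1 hx
      exact ⟨t, Subtype.ext (by simp only [f, ht]; field_simp)⟩
  rw [← Nat.card_congr (Equiv.ofBijective f hf), Nat.card_prod, Nat.card_zmod, sq]

theorem card_ker_polarMap_eq_or (hp : p ≠ 2)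
    (hfix : ∀ x, s x = x → ∃ c : ZMod p, algebraMap (ZMod p) F c = x) {z₀ : F} (hz₀ : z₀ ≠ 0)
    (hz : s z₀ = -z₀) {a : F} (ha : a ≠ 0) :
    Nat.card (LinearMap.ker (polarMap s a)) = 1 ∨
      Nat.card (LinearMap.ker (polarMap s a)) = p ^ 2 := by
  by_cases h : ∃ x₀, x₀ ≠ 0 ∧ polarMap s a x₀ = 0
  · obtain ⟨x₀, hx₀, h⟩ := h
    exact Or.inr (card_ker_polarMap_of_exists s hp hfix hz₀ hz ha hx₀ h)
  · push Not at h
    left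
    have : LinearMap.ker (polarMap s a) = ⊥ := by
      rw [LinearMap.ker_eq_bot']
      intro x hx
      by_contra hx0
      exact h x hx0 hx
    rw [this]
    simp

open Classical in
/-- The number of `a ≠ 0` whose quadratic form is degenerate. -/
theorem card_degenerate (hp : p ≠ 2)
    (hfix : ∀ x, s x = x → ∃ c : ZMod p, algebraMap (ZMod p) F c = x) {z₀ : F} (hz₀ : z₀ ≠ 0)
    (hz : s z₀ = -z₀) :
    (Finset.univ.filter fun a : F => a ≠ 0 ∧
      Nat.card (LinearMap.ker (polarMap s a)) = p ^ 2).card * (p + 1) = Fintype.card F - 1 := by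
  classical
  set U : Finset F := Finset.univ.erase 0 with hU
  have hUc : U.card = Fintype.card F - 1 := by
    rw [hU, Finset.card_erase_of_mem (Finset.mem_univ _), Finset.card_univ]
  -- Count the pairs of nonzero `(a, x)` with `x` in the radical of `a`. Each `x` admits the `p - 1`
  -- values `a = c z₀ / (x s(x))`; each degenerate `a` admits `p^2 - 1` vectors.
  have hswap := Finset.sum_card_bipartiteAbove_eq_sum_card_bipartiteBelow
    (s := U) (t := U) (fun a x => polarMap s a x = 0)
  have hright : ∀ x ∈ U, (U.bipartiteBelow (fun a x => polarMap s a x = 0) x).card = p - 1 := by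
    intro x hx
    have hx0 : x ≠ 0 := Finset.ne_of_mem_erase hx
    have hN : x * s x ≠ 0 := mul_ne_zero hx0 (by simpa using hx0)
    have : U.bipartiteBelow (fun a x => polarMap s a x = 0) x =
        (Finset.univ.erase (0 : ZMod p)).image
          fun c => algebraMap (ZMod p) F c * z₀ / (x * s x) := by
      ext a
      simp only [Finset.mem_bipartiteBelow, hU, Finset.mem_erase, Finset.mem_univ, and_true,
        Finset.mem_image, polarMap_eq_zero_iff_of_ne_zero s hx0,
        exists_algebraMap_mul_of_apply_eq_neg s hfix hz₀ hz]
      constructor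
      · rintro ⟨ha, c, hc⟩
        refine ⟨c, ?_, by rw [hc, mul_div_cancel_right₀ _ hN]⟩
        rintro rfl
        rw [map_zero, zero_mul] at hc
        exact mul_ne_zero ha hN hc.symm
      · rintro ⟨c, hc, rfl⟩
        exact ⟨div_ne_zero (mul_ne_zero (by simpa using hc) hz₀) hN, c,
          (div_mul_cancel₀ _ hN).symm⟩
    rw [this, Finset.card_image_of_injective, Finset.card_erase_of_mem (Finset.mem_univ _),
      Finset.card_univ, ZMod.card]
    intro c d hcd
    simp only [div_left_inj' hN, mul_left_inj' hz₀] at hcd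
    exact (algebraMap (ZMod p) F).injective hcd
  have hleft : ∀ a ∈ U, (U.bipartiteAbove (fun a x => polarMap s a x = 0) a).card =
      if Nat.card (LinearMap.ker (polarMap s a)) = p ^ 2 then p ^ 2 - 1 else 0 := by
    intro a ha
    have hc : (U.bipartiteAbove (fun a x => polarMap s a x = 0) a).card =
        Nat.card (LinearMap.ker (polarMap s a)) - 1 := by
      have : U.bipartiteAbove (fun a x => polarMap s a x = 0) a =
          (Finset.univ.filter fun x => x ∈ LinearMap.ker (polarMap s a)).erase 0 := by
        ext x
        simp [hU, Finset.bipartiteAbove]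
      rw [this, Finset.card_erase_of_mem (by simp), Nat.card_eq_fintype_card,
        Fintype.card_subtype]
    rw [hc]
    split_ifs with h
    · rw [h]
    · rw [(card_ker_polarMap_eq_or s hp hfix hz₀ hz (Finset.ne_of_mem_erase ha)).resolve_right h]
  rw [Finset.sum_congr rfl hleft, Finset.sum_congr rfl hright, Finset.sum_const, smul_eq_mul,
    hUc, ← Finset.sum_filter, Finset.sum_const, smul_eq_mul] at hswap
  have hset : (Finset.univ.filter fun a : F => a ≠ 0 ∧
      Nat.card (LinearMap.ker (polarMap s a)) = p ^ 2) =
      U.filter fun a => Nat.card (LinearMap.ker (polarMap s a)) = p ^ 2 := by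
    ext a
    simp [hU]
  rw [hset]
  have hp1 := (Fact.out : p.Prime).one_lt
  refine Nat.eq_of_mul_eq_mul_right (by omega : 0 < p - 1) ?_
  rw [← hswap, mul_assoc, ← Nat.sq_sub_sq, one_pow]

end SkewElement

/-! ### Even `m`: the skew element, and divisibility of level counts by `p + 1`. -/

section LevelCountsEven

variable {p : ℕ} [Fact p.Prime] {F : Type*} [Field F] [Fintype F] [Algebra (ZMod p) F]

/-- As `p + 1` is even, `2(p - 1)` divides `p^2 - 1` and hence `q - 1`. A root of unity `z` of order
`2(p - 1)` has `z^(p-1) = -1`, so Frobenius negates it, and so does any odd power of Frobenius. -/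
theorem exists_skew_element {k l : ℕ} (hp : p ≠ 2) (hF : Fintype.card F = p ^ (2 * k))
    (hl : Odd l) {α : F} (hα : IsPrimitiveRoot α (p ^ (2 * k) - 1)) :
    ∃ z₀ : F, z₀ ≠ 0 ∧ frobPow p F l z₀ = -z₀ := by
  have hp' := (Fact.out : p.Prime)
  have hodd := hp'.odd_of_ne_two hp
  have hp1 := hp'.one_lt
  have hk : k ≠ 0 := by
    rintro rfl
    exact absurd hF (by simpa using Fintype.one_lt_card.ne')
  have hpos : 0 < p ^ (2 * k) - 1 := Nat.sub_pos_of_lt (Nat.one_lt_pow (by omega) hp1)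
  obtain ⟨r, hr⟩ : 2 * (p - 1) ∣ p ^ (2 * k) - 1 := by
    have h1 : p ^ 2 - 1 ∣ (p ^ 2) ^ k - 1 := by simpa using Nat.sub_dvd_pow_sub_pow (p ^ 2) 1 k
    rw [← pow_mul] at h1
    refine dvd_trans ?_ h1
    have h2 : p ^ 2 - 1 = (p + 1) * (p - 1) := by rw [← Nat.sq_sub_sq, one_pow]
    rw [h2]
    exact mul_dvd_mul_right (hodd.add_odd odd_one).two_dvd _
  have hz : IsPrimitiveRoot (α ^ r) (2 * (p - 1)) := hα.pow hpos (by rw [hr, mul_comm])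
  have hz0 : α ^ r ≠ 0 := hz.ne_zero (by omega)
  have hneg : (α ^ r) ^ (p - 1) = -1 := by
    refine (mul_self_eq_one_iff.1 ?_).resolve_left
      (hz.pow_ne_one_of_pos_of_lt (by omega) (by omega))
    rw [← pow_add, ← two_mul, hz.pow_eq_one]
  have hpow : (α ^ r) ^ p = -(α ^ r) := by
    rw [← pow_sub_one_mul hp'.ne_zero, hneg, neg_one_mul]
  refine ⟨α ^ r, hz0, ?_⟩
  obtain ⟨j, rfl⟩ := hl
  rw [frobPow_apply]
  generalize α ^ r = z at hpow
  induction j with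
  | zero => simpa using hpow
  | succ j ih =>
    rw [show 2 * (j + 1) + 1 = 2 * j + 1 + 1 + 1 by ring, pow_succ, pow_succ, pow_mul, pow_mul, ih,
      hodd.neg_pow, hpow, neg_neg, hpow]

/-- For odd `l`, `p + 1` divides `p^l + 1`, so a `(p + 1)`-th root of unity `w` has `w s(w) = 1`.
These roots act on the level set by multiplication, freely because `c ≠ 0` excludes `x = 0`; the
orbits are the fibres of `x ↦ x^(p+1)`. -/
theorem dvd_levelCount {k l : ℕ} (hF : Fintype.card F = p ^ (2 * k))
    (hl : Odd l) {α : F} (hα : IsPrimitiveRoot α (p ^ (2 * k) - 1)) (a : F) {c : ZMod p}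
    (hc : c ≠ 0) : p + 1 ∣ levelCount (frobPow p F l) a c := by
  classical
  have hp := (Fact.out : p.Prime)
  have hk : k ≠ 0 := by
    rintro rfl
    exact absurd hF (by simpa using Fintype.one_lt_card.ne')
  have hdvd : p + 1 ∣ p ^ (2 * k) - 1 := by
    rw [pow_mul]
    have h1 : p ^ 2 - 1 ∣ (p ^ 2) ^ k - 1 := by simpa using Nat.sub_dvd_pow_sub_pow (p ^ 2) 1 k
    refine dvd_trans ⟨p - 1, ?_⟩ h1
    rw [← Nat.sq_sub_sq, one_pow]
  obtain ⟨r, hr⟩ := hdvd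
  have hpos : 0 < p ^ (2 * k) - 1 := Nat.sub_pos_of_lt (Nat.one_lt_pow (by omega) hp.one_lt)
  have hζ : IsPrimitiveRoot (α ^ r) (p + 1) := hα.pow hpos (by rw [hr, mul_comm])
  rw [levelCount, Finset.card_eq_sum_card_image (fun x : F => x ^ (p + 1))]
  refine Finset.dvd_sum fun y hy => ?_
  obtain ⟨x₀, hx₀, rfl⟩ := Finset.mem_image.1 hy
  have hx₀' := (Finset.mem_filter.1 hx₀).2
  have hx0 : x₀ ≠ 0 := by
    rintro rfl
    exact hc (by rw [← hx₀', quadTrace_zero_right])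
  suffices h : ({x ∈ Finset.univ.filter (fun x => quadTrace (frobPow p F l) a x = c) |
      x ^ (p + 1) = x₀ ^ (p + 1)}).card = (nthRootsFinset (p + 1) (1 : F)).card by
    rw [h, hζ.card_nthRootsFinset]
  symm
  refine Finset.card_equiv (Equiv.mulRight₀ x₀ hx0) fun w => ?_
  rw [mem_nthRootsFinset (Nat.succ_pos p)]
  simp only [Finset.mem_filter, Finset.mem_univ, true_and, Equiv.mulRight₀_apply, mul_pow]
  have hcancel : w ^ (p + 1) * x₀ ^ (p + 1) = x₀ ^ (p + 1) ↔ w ^ (p + 1) = 1 :=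
    mul_eq_right₀ (pow_ne_zero _ hx0)
  rw [hcancel]
  refine ⟨fun hw => ⟨?_, hw⟩, fun h => h.2⟩
  have hN : w * frobPow p F l w = 1 := by
    obtain ⟨j, rfl⟩ := hl
    have hd : p + 1 ∣ p ^ (2 * j + 1) + 1 := by
      simpa using (odd_two_mul_add_one j).nat_add_dvd_pow_add_pow p 1
    obtain ⟨e, he⟩ := hd
    rw [frobPow_apply, ← pow_succ', he, pow_mul, hw, one_pow]
  rw [← hx₀', quadTrace, quadTrace, map_mul (frobPow p F l)]
  congr 1
  linear_combination a * x₀ * (frobPow p F l x₀) * hN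

end LevelCountsEven

/-! ### Even `m`: the exact level counts. -/

section LevelCountsEvenValues

variable {p : ℕ} [Fact p.Prime] {F : Type*} [Field F] [Fintype F] [Algebra (ZMod p) F]

/-- Modulo `p + 1` one has `(-p)^j ≡ 1` and `t ≡ -1`; the two signs are distinguished because `p + 1
> 2`. -/
theorem eq_neg_neg_pow_of_sq_eq (hp : 3 ≤ p) {t : ℤ} {j : ℕ} (ht : t ^ 2 = (p ^ j) ^ 2)
    (hdvd : (p : ℤ) + 1 ∣ t + 1) : t = -(-p) ^ j := by
  have hpj : (p : ℤ) + 1 ∣ (-p) ^ j - 1 := by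
    have := sub_dvd_pow_sub_pow (-(p : ℤ)) 1 j
    rw [one_pow] at this
    exact dvd_trans ⟨-1, by ring⟩ this
  have h1 : t ^ 2 = ((-p) ^ j) ^ 2 := by
    rw [ht, ← pow_mul, ← pow_mul, mul_comm j 2, pow_mul, pow_mul, neg_sq]
  rcases sq_eq_sq_iff_eq_or_eq_neg.1 h1 with h | h
  · rw [h] at hdvd
    have := Int.le_of_dvd (by norm_num) ((by simpa using dvd_sub hdvd hpj :
      (p : ℤ) + 1 ∣ 1 + 1))
    omega
  · exact h

variable {k l : ℕ}

/-- The level counts for even `m = 2 k`, in terms of the size of the radical. -/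
theorem levelCount_of_even (hp : p ≠ 2) (hF : Fintype.card F = p ^ (2 * k))
    (hk : k ≠ 0) (hml : Nat.Coprime (2 * k) l) {α : F}
    (hα : IsPrimitiveRoot α (p ^ (2 * k) - 1)) (a : F) {j : ℕ}
    (hj : p ^ (2 * j + 2) = p ^ (2 * k) * Nat.card (LinearMap.ker (polarMap (frobPow p F l) a))) :
    (levelCount (frobPow p F l) a 0 : ℤ) = p ^ (2 * k - 1) - (p - 1) * (-p) ^ j ∧
      ∀ c : ZMod p, c ≠ 0 →
        (levelCount (frobPow p F l) a c : ℤ) = p ^ (2 * k - 1) + (-p) ^ j := by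
  have hl : Odd l := Nat.coprime_two_left.1 (Nat.Coprime.coprime_mul_right hml)
  obtain ⟨z₀, hz₀, hz⟩ := exists_skew_element hp hF hl hα
  have hfix := fun x => exists_algebraMap_eq_of_frobPow_eq (x := x) hF hml
  have hp' := (Fact.out : p.Prime)
  have hp3 : 3 ≤ p := by
    have := hp'.two_le
    omega
  have hp0 : (p : ℤ) ≠ 0 := by omega
  have hp1 : (p : ℤ) - 1 ≠ 0 := by omega
  set N : ZMod p → ℕ := levelCount (frobPow p F l) a with hN
  set r := Nat.card (LinearMap.ker (polarMap (frobPow p F l) a)) with hr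
  have hconst : ∀ c, c ≠ 0 → N c = N 1 := fun c hc =>
    levelCount_eq_levelCount_one _ hp hfix hz₀ hz a hc
  have hq : (Fintype.card F : ℤ) = p * p ^ (2 * k - 1) := by
    rw [hF, ← mul_pow_sub_one (by omega : 2 * k ≠ 0) p]
    push_cast
    rfl
  have hsplit : ∀ f : ℕ → ℤ, ∑ c, f (N c) = f (N 0) + (p - 1) * f (N 1) := by
    intro f
    classical
    rw [← Finset.add_sum_erase _ _ (Finset.mem_univ (0 : ZMod p)),
      Finset.sum_congr rfl fun c hc => by rw [hconst c (Finset.ne_of_mem_erase hc)],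
      Finset.sum_const, Finset.card_erase_of_mem (Finset.mem_univ _), Finset.card_univ, ZMod.card,
      nsmul_eq_mul, Nat.cast_sub hp'.one_le]
    simp
  have h1 := congrArg (Nat.cast : ℕ → ℤ) (sum_levelCount (frobPow p F l) a)
  push_cast at h1
  have h1' := hsplit fun n => n
  rw [h1, hq] at h1'
  have h2 := sum_levelCount_sq (frobPow p F l) hp a
  rw [hsplit fun n => (n : ℤ) ^ 2, hq, ← hr] at h2
  have h3 : ((p : ℤ) ^ j) ^ 2 * p = p ^ (2 * k - 1) * r := by
    have := congrArg (Nat.cast : ℕ → ℤ) hj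
    rw [← mul_pow_sub_one (by omega : 2 * k ≠ 0) p] at this
    push_cast at this
    refine mul_left_cancel₀ hp0 ?_
    rw [← mul_assoc (p : ℤ) (p ^ (2 * k - 1)), ← this]
    ring
  set Q : ℤ := p ^ (2 * k - 1) with hQ
  -- The first moment expresses `N 0` through `N 1`; the second moment then becomes this equation.
  have ht : (Q - N 1) ^ 2 = ((p : ℤ) ^ j) ^ 2 := by
    refine mul_left_cancel₀ hp0 (mul_left_cancel₀ hp0 (mul_left_cancel₀ hp1 ?_))
    have hN0 : (N 0 : ℤ) = p * Q - (p - 1) * N 1 := by linear_combination -h1'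
    rw [hN0] at h2
    linear_combination h2 - p * (p - 1) * h3
  have hd1 : (p : ℤ) + 1 ∣ N 1 := by
    have := dvd_levelCount hF hl hα a (one_ne_zero (α := ZMod p))
    exact_mod_cast this
  have hdQ : (p : ℤ) + 1 ∣ Q + 1 := by
    have := (show Odd (2 * k - 1) from ⟨k - 1, by omega⟩).add_dvd_pow_add_pow (p : ℤ) 1
    rwa [one_pow] at this
  have hd : (p : ℤ) + 1 ∣ (Q - N 1) + 1 := by
    have := dvd_sub hdQ hd1
    rwa [show Q + 1 - (N 1 : ℤ) = Q - N 1 + 1 by ring] at this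
  have hfin := eq_neg_neg_pow_of_sq_eq hp3 ht hd
  constructor
  · linear_combination -h1' + (p - 1) * hfin
  · intro c hc
    rw [hconst c hc]
    linear_combination -hfin

/-- How often each level count occurs, given that the level counts off `0` agree. -/
theorem levelCountFreq_of_const (s : F ≃ₐ[ZMod p] F) (a : F) {M : ℕ}
    (hM : ∀ c : ZMod p, c ≠ 0 → levelCount s a c = M) (n : ℕ) :
    levelCountFreq s a n =
      (if levelCount s a 0 = n then 1 else 0) + if M = n then p - 1 else 0 := by
  classical
  rw [levelCountFreq, Finset.card_filter,
    ← Finset.add_sum_erase _ _ (Finset.mem_univ (0 : ZMod p)),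
    Finset.sum_congr rfl fun c hc => by rw [hM c (Finset.ne_of_mem_erase hc)], Finset.sum_const,
    Finset.card_erase_of_mem (Finset.mem_univ _), Finset.card_univ, ZMod.card]
  simp

end LevelCountsEvenValues

/-! ### Duality of linear codes. -/

section Duality

variable {K : Type*} [Field K] {ι : Type*} [Fintype ι]

theorem mem_dualCode {D : Submodule K (ι → K)} {x : ι → K} :
    x ∈ dualCode D ↔ ∀ c ∈ D, ∑ i, c i * x i = 0 := Iff.rfl

theorem dualCode_antitone {D E : Submodule K (ι → K)} (h : D ≤ E) : dualCode E ≤ dualCode D :=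
  fun _ hx c hc => hx c (h hc)

theorem dualCode_dualCode (D : Submodule K (ι → K)) : dualCode (dualCode D) = D := by
  classical
  have hB : (dotProductBilin K K : LinearMap.BilinForm K (ι → K)).Nondegenerate := by
    constructor <;>
    · intro x hx
      ext i
      simpa using hx (Pi.single i 1)
  have hrefl : (dotProductBilin K K : LinearMap.BilinForm K (ι → K)).IsRefl := by
    intro x y h
    simpa [dotProduct_comm] using h
  have hdual : ∀ E : Submodule K (ι → K),
      dualCode E = LinearMap.BilinForm.orthogonal (dotProductBilin K K) E := by
    intro E
    ext x
    rfl
  rw [hdual, hdual, LinearMap.BilinForm.orthogonal_orthogonal hB hrefl]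

end Duality

/-! ### Cyclic codes with two nonconjugate nonzeros as trace codes. -/

section CyclicTrace

variable {K L : Type*} [Field K] [Field L] [Fintype L] [Algebra K L]

theorem aeval_wordPoly {n : ℕ} (c : Fin n → K) (z : L) :
    aeval z (wordPoly c) = ∑ i : Fin n, algebraMap K L (c i) * z ^ (i : ℕ) := by
  simp [wordPoly]

theorem sum_pow_eq_zero_of_ne_one {n : ℕ} {z : L} (hz : z ^ n = 1) (h1 : z ≠ 1) :
    ∑ i : Fin n, z ^ (i : ℕ) = 0 := by
  rw [Fin.sum_univ_eq_sum_range (fun i => z ^ i)]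
  exact (mul_eq_zero.1 ((geom_sum_mul z n).trans (by rw [hz, sub_self]))).resolve_right
    (sub_ne_zero.2 h1)

/-- The word `i ↦ Tr (a β⁻ⁱ + b α⁻ⁱ)`, as a linear function of `(a, b)`. -/
noncomputable def cyclicTraceWord (K : Type*) {L : Type*} [Field K] [Field L] [Algebra K L]
    (n : ℕ) (α β : L) : L × L →ₗ[K] (Fin n → K) where
  toFun t := fun i => Algebra.trace K L (t.1 * β⁻¹ ^ (i : ℕ) + t.2 * α⁻¹ ^ (i : ℕ))
  map_add' t t' := by
    ext i
    simp only [Prod.fst_add, Prod.snd_add, Pi.add_apply, ← map_add]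
    congr 1
    ring
  map_smul' r t := by
    ext i
    simp only [Prod.smul_fst, Prod.smul_snd, Pi.smul_apply, RingHom.id_apply, smul_mul_assoc,
      ← smul_add, map_smul]

variable [Finite K] {n : ℕ} {α β : L}

theorem minpoly_mul_minpoly_dvd (hα : α ^ n = 1) (hβ : β ^ n = 1)
    (hαβ : ∀ τ : L ≃ₐ[K] L, τ β ≠ α) : minpoly K α * minpoly K β ∣ X ^ n - 1 := by
  refine IsCoprime.mul_dvd ?_ (minpoly.dvd K α (by simp [hα])) (minpoly.dvd K β (by simp [hβ]))
  refine ((minpoly.irreducible (Algebra.IsIntegral.isIntegral α)).isCoprime_or_dvd _).resolve_right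
    fun h => ?_
  obtain ⟨τ, hτ⟩ := minpoly.exists_algEquiv_of_root' (Algebra.IsAlgebraic.isAlgebraic β)
    (aeval_eq_zero_of_dvd_aeval_eq_zero h (minpoly.aeval K α))
  exact hαβ τ hτ

theorem X_pow_sub_one_dvd_iff (hn : 0 < n) (hα : IsPrimitiveRoot α n) (f : K[X]) :
    X ^ n - 1 ∣ f ↔ ∀ z : L, z ^ n = 1 → aeval z f = 0 := by
  constructor
  · rintro ⟨g, rfl⟩ z hz
    simp [hz]
  · intro h
    rw [← map_dvd_map' (algebraMap K L)]
    simp only [Polynomial.map_sub, Polynomial.map_pow, map_X, Polynomial.map_one]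
    rw [X_pow_sub_one_eq_prod hn hα]
    refine Finset.prod_dvd_of_coprime ?_ fun z hz => ?_
    · intro z _ w _ hzw
      exact isCoprime_X_sub_C_of_isUnit_sub (sub_ne_zero.2 hzw).isUnit
    · rw [dvd_iff_isRoot, IsRoot, eval_map_algebraMap]
      exact h z ((mem_nthRootsFinset hn 1).1 hz)

/-- Written as a sum over automorphisms `τ`, the trace gives geometric sums with ratios `τ(α⁻¹) z`
and `τ(β⁻¹) z`; these vanish unless `z` is conjugate to `α` or `β`. This is why inverse powers
appear in the trace words. -/
theorem aeval_cyclicTraceWord (hn : 0 < n) (hα : α ^ n = 1) (hβ : β ^ n = 1) (t : L × L) {z : L}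
    (hz : z ^ n = 1) (h1 : aeval z (minpoly K α) ≠ 0) (h3 : aeval z (minpoly K β) ≠ 0) :
    aeval z (wordPoly (cyclicTraceWord K n α β t)) = 0 := by
  have key : ∀ (γ : L), γ ^ n = 1 → aeval z (minpoly K γ) ≠ 0 → ∀ τ : L ≃ₐ[K] L,
      ∑ i : Fin n, (τ γ⁻¹ * z) ^ (i : ℕ) = 0 := by
    intro γ hγ h τ
    have hγ0 : τ γ ≠ 0 := by
      intro h0
      rw [EmbeddingLike.map_eq_zero_iff] at h0
      subst h0
      simp [zero_pow hn.ne'] at hγ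
    refine sum_pow_eq_zero_of_ne_one ?_ fun h' => h ?_
    · rw [mul_pow, hz, mul_one, ← map_pow, inv_pow, hγ, inv_one, map_one]
    · rw [map_inv₀, inv_mul_eq_one₀ hγ0] at h'
      rw [← h', aeval_algHom_apply, minpoly.aeval, map_zero]
  have htr : ∀ i : Fin n, algebraMap K L (cyclicTraceWord K n α β t i) * z ^ (i : ℕ) =
      ∑ τ : L ≃ₐ[K] L, (τ t.1 * (τ β⁻¹ * z) ^ (i : ℕ) + τ t.2 * (τ α⁻¹ * z) ^ (i : ℕ)) := by
    intro i
    change algebraMap K L (Algebra.trace K L _) * _ = _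
    rw [trace_eq_sum_automorphisms, Finset.sum_mul]
    refine Finset.sum_congr rfl fun τ _ => ?_
    simp only [map_add, map_mul, map_pow, mul_pow]
    ring
  rw [aeval_wordPoly, Finset.sum_congr rfl fun i _ => htr i, Finset.sum_comm]
  refine Finset.sum_eq_zero fun τ _ => ?_
  rw [Finset.sum_add_distrib, ← Finset.mul_sum, ← Finset.mul_sum, key β hβ h3 τ, key α hα h1 τ]
  simp

/-- The words of a cyclic code, evaluated at the roots of unity. -/
theorem mem_cyclicCode_iff (hn : 0 < n) (hα : IsPrimitiveRoot α n) {h : K[X]}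
    (hdvd : h ∣ X ^ n - 1) (c : Fin n → K) :
    c ∈ cyclicCode n h ↔ ∀ z : L, z ^ n = 1 → aeval z h ≠ 0 → aeval z (wordPoly c) = 0 := by
  have hX : (X ^ n - 1 : K[X]) ≠ 0 := X_pow_sub_C_ne_zero hn 1
  have hh0 : h ≠ 0 := ne_zero_of_dvd_ne_zero hX hdvd
  have hmul : h * ((X ^ n - 1) / h) = X ^ n - 1 := EuclideanDomain.mul_div_cancel' hh0 hdvd
  change (X ^ n - 1) / h ∣ wordPoly c ↔ _
  rw [← mul_dvd_mul_iff_left hh0, hmul, X_pow_sub_one_dvd_iff hn hα]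
  simp only [map_mul, mul_eq_zero]
  exact forall₂_congr fun z _ => or_iff_not_imp_left

theorem range_cyclicTraceWord_le (hn : 0 < n) (hα : IsPrimitiveRoot α n) (hβ : β ^ n = 1)
    (hαβ : ∀ τ : L ≃ₐ[K] L, τ β ≠ α) :
    LinearMap.range (cyclicTraceWord K n α β) ≤ cyclicCode n (minpoly K α * minpoly K β) := by
  rintro _ ⟨t, rfl⟩
  rw [mem_cyclicCode_iff hn hα (minpoly_mul_minpoly_dvd hα.pow_eq_one hβ hαβ)]
  intro z hz hne
  rw [map_mul, mul_ne_zero_iff] at hne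
  exact aeval_cyclicTraceWord hn hα.pow_eq_one hβ t hz hne.1 hne.2

theorem sum_mul_aeval_inv_eq_zero {x : Fin n → K}
    (hx : x ∈ dualCode (LinearMap.range (cyclicTraceWord K n α β))) :
    aeval α⁻¹ (wordPoly x) = 0 ∧ aeval β⁻¹ (wordPoly x) = 0 := by
  have key : ∀ a b : L, Algebra.trace K L
      (a * aeval β⁻¹ (wordPoly x) + b * aeval α⁻¹ (wordPoly x)) = 0 := by
    intro a b
    have := hx _ ⟨(a, b), rfl⟩
    rw [← this, aeval_wordPoly, aeval_wordPoly, Finset.mul_sum, Finset.mul_sum,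
      ← Finset.sum_add_distrib, map_sum]
    refine Finset.sum_congr rfl fun i _ => ?_
    change _ = Algebra.trace K L _ * x i
    rw [mul_comm _ (x i), ← smul_eq_mul (x i), ← map_smul, Algebra.smul_def]
    congr 1
    ring
  have hnd := (traceForm_nondegenerate K L).1
  constructor
  · refine hnd _ fun b => ?_
    have := key 0 b
    rwa [zero_mul, zero_add, mul_comm] at this
  · refine hnd _ fun a => ?_
    have := key a 0
    rwa [zero_mul, add_zero, mul_comm] at this

/-- By double duality it suffices that a codeword `c` is orthogonal to every `x` dual to the trace
words. By Parseval, `n ∑ c_i x_i` is the sum over `k` of the value of `c` at `α^k` times the value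
of `x` at `α^(-k)`. If `α^k` is conjugate to `α` or `β` the second factor vanishes, otherwise the
first. -/
theorem cyclicCode_le_range (hn : 0 < n) (hn' : (n : L) ≠ 0) (hα : IsPrimitiveRoot α n)
    (hβ : β ^ n = 1) (hαβ : ∀ τ : L ≃ₐ[K] L, τ β ≠ α) :
    cyclicCode n (minpoly K α * minpoly K β) ≤ LinearMap.range (cyclicTraceWord K n α β) := by
  rw [← dualCode_dualCode (LinearMap.range (cyclicTraceWord K n α β)),
    ← dualCode_dualCode (cyclicCode n _)]
  refine dualCode_antitone fun x hx c hc => ?_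
  rw [mem_cyclicCode_iff hn hα (minpoly_mul_minpoly_dvd hα.pow_eq_one hβ hαβ)] at hc
  obtain ⟨hx1, hx3⟩ := sum_mul_aeval_inv_eq_zero hx
  have hconj : ∀ γ z : L, aeval γ⁻¹ (wordPoly x) = 0 → aeval z (minpoly K γ) = 0 →
      aeval z⁻¹ (wordPoly x) = 0 := by
    intro γ z hγ hz
    obtain ⟨τ, rfl⟩ := minpoly.exists_algEquiv_of_root' (Algebra.IsAlgebraic.isAlgebraic γ) hz
    rw [← map_inv₀, aeval_algHom_apply, hγ, map_zero]
  have hzero : ∀ k : ℕ, aeval (α ^ k) (wordPoly c) * aeval (α ^ k)⁻¹ (wordPoly x) = 0 := by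
    intro k
    by_cases hk : aeval (α ^ k) (minpoly K α * minpoly K β) = 0
    · rw [map_mul, mul_eq_zero] at hk
      rcases hk with hk | hk
      · rw [hconj _ _ hx1 hk, mul_zero]
      · rw [hconj _ _ hx3 hk, mul_zero]
    · rw [hc _ (by rw [← pow_mul, mul_comm, pow_mul, hα.pow_eq_one, one_pow]) hk, zero_mul]
  have hα0 : α ≠ 0 := hα.ne_zero hn.ne'
  have horth : ∀ i j : Fin n, ∑ k : Fin n, (α ^ (k : ℕ)) ^ (i : ℕ) * (α ^ (k : ℕ))⁻¹ ^ (j : ℕ) =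
      if i = j then (n : L) else 0 := by
    intro i j
    have : ∀ k : Fin n, (α ^ (k : ℕ)) ^ (i : ℕ) * (α ^ (k : ℕ))⁻¹ ^ (j : ℕ) =
        (α ^ (i : ℕ) / α ^ (j : ℕ)) ^ (k : ℕ) := by
      intro k
      rw [div_pow, div_eq_mul_inv, inv_pow, ← pow_mul, ← pow_mul, ← pow_mul, ← pow_mul,
        mul_comm (i : ℕ), mul_comm (j : ℕ)]
    rw [Finset.sum_congr rfl fun k _ => this k]
    split_ifs with hij
    · subst hij
      rw [div_self (pow_ne_zero _ hα0)]
      simp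
    · refine sum_pow_eq_zero_of_ne_one ?_ fun h => hij ?_
      · rw [div_pow, ← pow_mul, ← pow_mul, mul_comm, pow_mul, hα.pow_eq_one, mul_comm, pow_mul,
          hα.pow_eq_one]
        simp
      · rw [div_eq_one_iff_eq (pow_ne_zero _ hα0)] at h
        exact Fin.ext (hα.pow_inj i.2 j.2 h)
  have hsum : (n : L) * algebraMap K L (∑ i, c i * x i) = 0 := by
    rw [← Finset.sum_eq_zero fun (k : Fin n) _ => hzero k]
    simp only [aeval_wordPoly, Finset.sum_mul_sum]
    rw [Finset.sum_comm]
    rw [Finset.sum_congr rfl fun i _ => Finset.sum_comm]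
    rw [map_sum, Finset.mul_sum]
    refine Finset.sum_congr rfl fun i _ => ?_
    have : ∀ j : Fin n, ∑ k : Fin n, algebraMap K L (c i) * (α ^ (k : ℕ)) ^ (i : ℕ) *
        (algebraMap K L (x j) * (α ^ (k : ℕ))⁻¹ ^ (j : ℕ)) =
        algebraMap K L (c i) * algebraMap K L (x j) * if i = j then (n : L) else 0 := by
      intro j
      rw [← horth, Finset.mul_sum]
      exact Finset.sum_congr rfl fun k _ => by ring
    rw [Finset.sum_congr rfl fun j _ => this j]
    simp
    ring
  exact (map_eq_zero _).1 ((mul_eq_zero.1 hsum).resolve_left hn')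

theorem mem_cyclicCode_iff_exists_trace (hn : 0 < n) (hn' : (n : L) ≠ 0)
    (hα : IsPrimitiveRoot α n) (hβ : β ^ n = 1) (hαβ : ∀ τ : L ≃ₐ[K] L, τ β ≠ α)
    (c : Fin n → K) :
    c ∈ cyclicCode n (minpoly K α * minpoly K β) ↔ ∃ a b : L, ∀ i : Fin n,
      c i = Algebra.trace K L (a * β⁻¹ ^ (i : ℕ) + b * α⁻¹ ^ (i : ℕ)) := by
  rw [le_antisymm (cyclicCode_le_range hn hn' hα hβ hαβ)
    (range_cyclicTraceWord_le hn hα hβ hαβ)]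
  constructor
  · rintro ⟨t, rfl⟩
    exact ⟨t.1, t.2, fun i => rfl⟩
  · rintro ⟨a, b, h⟩
    exact ⟨(a, b), (funext h).symm⟩

end CyclicTrace

/-! ### The trace description of the dual of the extended dual. -/

section ExtendedTraceCode

variable {p : ℕ} [Fact p.Prime] {F : Type*} [Field F] [Fintype F] [Algebra (ZMod p) F]

/-- Otherwise `τ(x^(p^l+1)) = x` would hold on all powers of `α`, hence on all of `F`; but the
exponent is even, so `x = -1` would give `1 = -1`. -/
theorem algEquiv_pow_ne (hp : p ≠ 2) {m l : ℕ} (hF : Fintype.card F = p ^ m) {α : F}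
    (hα : IsPrimitiveRoot α (p ^ m - 1)) (τ : F ≃ₐ[ZMod p] F) : τ (α ^ (p ^ l + 1)) ≠ α := by
  intro h
  have hpos : 0 < p ^ m - 1 := by
    rw [← hF]
    exact Nat.sub_pos_of_lt Fintype.one_lt_card
  have key : ∀ x : F, τ (x ^ (p ^ l + 1)) = x := by
    intro x
    by_cases hx : x = 0
    · subst hx
      simp
    · have : NeZero (p ^ m - 1) := ⟨hpos.ne'⟩
      obtain ⟨i, _, rfl⟩ := hα.eq_pow_of_pow_eq_one
        (show x ^ (p ^ m - 1) = 1 by rw [← hF, FiniteField.pow_card_sub_one_eq_one x hx])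
      rw [← pow_mul, mul_comm, pow_mul, map_pow, h]
  have h1 := key (-1)
  rw [(((Fact.out : p.Prime).odd_of_ne_two hp).pow.add_odd odd_one).neg_one_pow, map_one] at h1
  exact two_ne_zero_of_algebra_zmod (F := F) (p := p) hp (by linear_combination h1)

/-- The labelling of the coordinates: `i ↦ α⁻ⁱ`, and `0` for the extension coordinate. -/
noncomputable def labelFun (n : ℕ) (α : F) : Fin (n + 1) → F :=
  Fin.snoc (α := fun _ => F) (fun i : Fin n => α⁻¹ ^ (i : ℕ)) 0

theorem labelFun_castSucc (n : ℕ) (α : F) (i : Fin n) :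
    labelFun n α i.castSucc = α⁻¹ ^ (i : ℕ) := by
  simp [labelFun]

theorem labelFun_last (n : ℕ) (α : F) : labelFun n α (Fin.last n) = 0 := by
  simp [labelFun]

theorem labelFun_bijective {n : ℕ} {α : F} (hα : IsPrimitiveRoot α n)
    (hF : Fintype.card F = n + 1) : Function.Bijective (labelFun n α) := by
  have hn : n ≠ 0 := by
    rintro rfl
    exact absurd hF (Fintype.one_lt_card).ne'
  rw [Fintype.bijective_iff_injective_and_card, Fintype.card_fin, hF]
  refine ⟨?_, rfl⟩
  have hα0 : α⁻¹ ≠ 0 := inv_ne_zero (hα.ne_zero hn)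
  intro i j
  refine Fin.lastCases ?_ (fun i => ?_) i <;> refine Fin.lastCases ?_ (fun j => ?_) j
  · intro _
    rfl
  · intro h
    rw [labelFun_last, labelFun_castSucc] at h
    exact absurd h.symm (pow_ne_zero _ hα0)
  · intro h
    rw [labelFun_last, labelFun_castSucc] at h
    exact absurd h (pow_ne_zero _ hα0)
  · intro h
    rw [labelFun_castSucc, labelFun_castSucc] at h
    rw [Fin.ext (hα.inv.pow_inj i.2 j.2 h)]

/-- The word `x ↦ Tr (a x s(x)) + Tr (b x) + h`, as a linear function of `(a, b, h)`. -/
noncomputable def affineTraceWord (s : F ≃ₐ[ZMod p] F) :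
    F × F × ZMod p →ₗ[ZMod p] (F → ZMod p) where
  toFun t := fun x => quadTrace s t.1 x + Algebra.trace (ZMod p) F (t.2.1 * x) + t.2.2
  map_add' t t' := by
    ext x
    simp only [quadTrace, Prod.fst_add, Prod.snd_add, Pi.add_apply, add_mul, map_add]
    ring
  map_smul' r t := by
    ext x
    simp only [quadTrace, Prod.smul_fst, Prod.smul_snd, Pi.smul_apply, RingHom.id_apply,
      smul_mul_assoc, map_smul, smul_eq_mul]
    ring

theorem affineTraceWord_apply (s : F ≃ₐ[ZMod p] F) (t : F × F × ZMod p) (x : F) :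
    affineTraceWord s t x =
      quadTrace s t.1 x + Algebra.trace (ZMod p) F (t.2.1 * x) + t.2.2 := rfl

/-- The code of all words `x ↦ Tr (a x s(x)) + Tr (b x) + h`. -/
noncomputable def affineTraceCode (s : F ≃ₐ[ZMod p] F) : Submodule (ZMod p) (F → ZMod p) :=
  LinearMap.range (affineTraceWord s)

theorem codeC2Bar_eq (hp : p ≠ 2) {m l : ℕ} (hF : Fintype.card F = p ^ m)
    {α : F} (hα : IsPrimitiveRoot α (p ^ m - 1)) :
    codeC2Bar p m l α = (affineTraceCode (frobPow p F l)).map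
      (LinearMap.funLeft (ZMod p) (ZMod p) (labelFun (p ^ m - 1) α)) := by
  set n := p ^ m - 1 with hn
  have hn1 : Fintype.card F = n + 1 := by
    rw [hF, hn, Nat.sub_add_cancel (Nat.one_le_pow _ _ (Fact.out : p.Prime).pos)]
  have hpos : 0 < n := by
    have := Fintype.one_lt_card (α := F)
    omega
  have hnF : (n : F) ≠ 0 := by
    intro h0
    have := FiniteField.cast_card_eq_zero F
    rw [hn1, Nat.cast_add, h0, zero_add, Nat.cast_one] at this
    exact one_ne_zero this
  have hβ : (α ^ (p ^ l + 1)) ^ n = 1 := by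
    rw [← pow_mul, mul_comm, pow_mul, hα.pow_eq_one, one_pow]
  have hC := mem_cyclicCode_iff_exists_trace hpos hnF hα hβ (algEquiv_pow_ne (l := l) hp hF hα)
  have hword : ∀ (a b : F) (i : Fin n), Algebra.trace (ZMod p) F
      (a * (α ^ (p ^ l + 1))⁻¹ ^ (i : ℕ) + b * α⁻¹ ^ (i : ℕ)) =
      affineTraceWord (frobPow p F l) (a, b, 0) (labelFun n α i.castSucc) := by
    intro a b i
    rw [affineTraceWord_apply, labelFun_castSucc, quadTrace, frobPow_apply, ← pow_succ',
      add_zero, ← map_add, ← inv_pow, ← pow_mul, ← pow_mul, mul_comm (p ^ l + 1)]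
  have hlast : ∀ (t : F × F × ZMod p), affineTraceWord (frobPow p F l) t
      (labelFun n α (Fin.last n)) = t.2.2 := by
    intro t
    rw [affineTraceWord_apply, labelFun_last]
    simp [quadTrace]
  have hshift : ∀ (t : F × F × ZMod p) (x : F), affineTraceWord (frobPow p F l) t x =
      affineTraceWord (frobPow p F l) (t.1, t.2.1, 0) x + t.2.2 := by
    intro t x
    simp [affineTraceWord_apply]
  -- It suffices to compare the dual codes. A trace word with `h = 0` vanishes at the label `0` of
  -- the last coordinate, so it tests only the first `n` coordinates; the constant word tests the
  -- sum condition.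
  rw [codeC2Bar, ← dualCode_dualCode (Submodule.map _ _)]
  congr 1
  ext x
  change ((fun i : Fin n => x i.castSucc) ∈ dualCode (codeC2 p m l α) ∧ ∑ i, x i = 0) ↔ _
  rw [mem_dualCode, mem_dualCode]
  constructor
  · rintro ⟨h1, h2⟩ _ ⟨_, ⟨t, rfl⟩, rfl⟩
    have h3 := h1 _ ((hC _).2 ⟨t.1, t.2.1, fun i => rfl⟩)
    simp only [hword] at h3
    simp only [LinearMap.funLeft_apply]
    rw [Finset.sum_congr rfl fun i _ => by rw [hshift t, add_mul], Finset.sum_add_distrib,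
      ← Finset.mul_sum, h2, mul_zero, add_zero, Fin.sum_univ_castSucc, h3, hlast]
    simp
  · intro h
    constructor
    · intro c hc
      obtain ⟨a, b, hab⟩ := (hC _).1 hc
      have h3 := h _ ⟨_, ⟨(a, b, 0), rfl⟩, rfl⟩
      simp only [LinearMap.funLeft_apply] at h3
      rw [Fin.sum_univ_castSucc, hlast] at h3
      simp only [zero_mul, add_zero] at h3
      rw [← h3]
      exact Finset.sum_congr rfl fun i _ => by rw [hab, hword]
    · have h3 := h _ ⟨_, ⟨(0, 0, 1), rfl⟩, rfl⟩
      simpa [LinearMap.funLeft_apply, affineTraceWord_apply, quadTrace] using h3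

end ExtendedTraceCode

/-! ### 2-designs from codes with a doubly transitive automorphism group. -/

section DesignsFromCodes

variable {K : Type*} [Field K] [Fintype K] [DecidableEq K] {ι : Type*} [Fintype ι]
  {V : Type*} [AddCommGroup V] [Module K V]

/-- The number of zero coordinates of a word. -/
def numZeros (c : ι → K) : ℕ := (Finset.univ.filter fun i => c i = 0).card

theorem hammingNorm_add_numZeros (c : ι → K) :
    hammingNorm c + numZeros c = Fintype.card ι := by
  rw [hammingNorm, numZeros, add_comm]
  exact Finset.card_filter_add_card_filter_not (s := Finset.univ) fun i => c i = 0

theorem card_wordSupport (c : ι → K) : (wordSupport c).card = hammingNorm c := rfl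

theorem mem_wordSupport {c : ι → K} {i : ι} : i ∈ wordSupport c ↔ c i ≠ 0 := by
  simp [wordSupport]

/-- Averaging over the scalars: words with the same support are proportional if no word of the
code has too many zeros. -/
theorem exists_smul_eq_of_wordSupport_eq (W : V →ₗ[K] (ι → K)) {n : ℕ}
    (hz : ∀ t, t ≠ 0 → ((Fintype.card K : ℤ) - 1) * numZeros (W t) <
      Fintype.card ι + (Fintype.card K - 2) * n) {t t' : V} (ht : numZeros (W t) = n)
    (hs : wordSupport (W t) = wordSupport (W t')) : ∃ u : K, u ≠ 0 ∧ t = u • t' := by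
  classical
  by_contra! hne
  have hzero : ∀ i, W t i = 0 ↔ W t' i = 0 := by
    intro i
    have : i ∈ wordSupport (W t) ↔ i ∈ wordSupport (W t') := by rw [hs]
    rw [mem_wordSupport, mem_wordSupport] at this
    exact not_iff_not.1 this
  have hK : 0 < ((Finset.univ : Finset K).erase 0).card := by
    rw [Finset.card_erase_of_mem (Finset.mem_univ _), Finset.card_univ]
    exact Nat.sub_pos_of_lt Fintype.one_lt_card
  have hKc : (((Finset.univ : Finset K).erase 0).card : ℤ) = Fintype.card K - 1 := by
    rw [Finset.card_erase_of_mem (Finset.mem_univ _), Finset.card_univ,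
      Nat.cast_sub Fintype.card_pos]
    simp
  -- The common zeros persist, and on the common support new zeros occur where the ratio of the
  -- words equals `u`.
  have hsplit : ∀ u : K, numZeros (W (t - u • t')) =
      n + ((wordSupport (W t)).filter fun i => W t i / W t' i = u).card := by
    intro u
    rw [← ht, numZeros, numZeros, ← Finset.card_union_of_disjoint]
    · congr 1
      ext i
      simp only [Finset.mem_filter, Finset.mem_univ, true_and, Finset.mem_union, mem_wordSupport,
        map_sub, map_smul, Pi.sub_apply, Pi.smul_apply, smul_eq_mul, sub_eq_zero]
      by_cases h : W t i = 0
      · simp [h, (hzero i).1 h]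
      · have h' : W t' i ≠ 0 := fun h' => h ((hzero i).2 h')
        simp [h, div_eq_iff h']
    · rw [Finset.disjoint_left]
      intro i h1 h2
      simp only [Finset.mem_filter, mem_wordSupport, Finset.mem_univ, true_and] at h1 h2
      exact h2.1 h1
  have hfib : ∑ u ∈ Finset.univ.erase (0 : K),
      ((wordSupport (W t)).filter fun i => W t i / W t' i = u).card =
      (wordSupport (W t)).card := by
    refine (Finset.card_eq_sum_card_fiberwise fun i hi => ?_).symm
    rw [Finset.mem_coe, mem_wordSupport] at hi
    simpa [hi] using fun h' => hi ((hzero i).2 h')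
  have hcard : ((wordSupport (W t)).card : ℤ) = Fintype.card ι - n := by
    rw [card_wordSupport, ← ht, ← hammingNorm_add_numZeros (W t)]
    push_cast
    ring
  -- Over `u ≠ 0` the zeros total `(|K| - 1) n + (|ι| - n) = |ι| + (|K| - 2) n`. The bound `hz` says
  -- exactly that each word has fewer zeros than this average.
  have hlt := Finset.sum_lt_sum_of_nonempty (Finset.card_pos.1 hK) fun u hu =>
    hz (t - u • t') (sub_ne_zero.2 (hne u (Finset.ne_of_mem_erase hu)))
  rw [← Finset.mul_sum, Finset.sum_congr rfl fun u _ => by rw [hsplit u, Nat.cast_add],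
    Finset.sum_add_distrib, ← Nat.cast_sum, ← Nat.cast_sum, hfib, hcard] at hlt
  simp only [Finset.sum_const, smul_eq_mul, nsmul_eq_mul, Nat.cast_mul, hKc] at hlt
  have : ((Fintype.card K : ℤ) - 1) * ((Fintype.card K - 1) * n + (Fintype.card ι - n)) =
    (Fintype.card K - 1) * (Fintype.card ι + (Fintype.card K - 2) * n) := by ring
  omega

variable [Fintype V]

/-- The number of supports of the words with `n` zeros. -/
theorem card_supportsOfWeight (W : V →ₗ[K] (ι → K)) {w n : ℕ} (hw : w + n = Fintype.card ι)
    (hw0 : w ≠ 0)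
    (hz : ∀ t, t ≠ 0 → ((Fintype.card K : ℤ) - 1) * numZeros (W t) <
      Fintype.card ι + (Fintype.card K - 2) * n) :
    (supportsOfWeight (LinearMap.range W) w).ncard * (Fintype.card K - 1) =
      (Finset.univ.filter fun t => numZeros (W t) = n).card := by
  classical
  have hnorm : ∀ t, hammingNorm (W t) = w ↔ numZeros (W t) = n := by
    intro t
    have := hammingNorm_add_numZeros (W t)
    omega
  set A := Finset.univ.filter fun t => numZeros (W t) = n with hA
  have hB : supportsOfWeight (LinearMap.range W) w = A.image fun t => wordSupport (W t) := by
    ext B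
    simp only [supportsOfWeight, hA, Finset.coe_image, Finset.coe_filter, Finset.mem_univ, true_and]
    constructor
    · rintro ⟨_, ⟨t, rfl⟩, h1, h2⟩
      exact ⟨t, (hnorm t).1 h1, h2⟩
    · rintro ⟨t, h1, h2⟩
      exact ⟨W t, ⟨t, rfl⟩, (hnorm t).2 h1, h2⟩
  rw [hB, Set.ncard_coe_finset, Finset.card_eq_sum_card_image (fun t => wordSupport (W t)),
    Finset.sum_const_nat]
  intro B hB
  obtain ⟨t₀, ht₀, rfl⟩ := Finset.mem_image.1 hB
  have ht₀n := (Finset.mem_filter.1 ht₀).2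
  have ht₀0 : t₀ ≠ 0 := by
    rintro rfl
    have := (hnorm 0).2 ht₀n
    simp at this
    exact hw0 this.symm
  have : {t ∈ A | wordSupport (W t) = wordSupport (W t₀)} =
      (Finset.univ.erase (0 : K)).image fun u => u • t₀ := by
    ext t
    simp only [hA, Finset.mem_filter, Finset.mem_univ, true_and, Finset.mem_image,
      Finset.mem_erase, and_true]
    constructor
    · rintro ⟨h1, h2⟩
      obtain ⟨u, hu, rfl⟩ := exists_smul_eq_of_wordSupport_eq W hz h1 h2
      exact ⟨u, hu, rfl⟩
    · rintro ⟨u, hu, rfl⟩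
      have h2 : wordSupport (W (u • t₀)) = wordSupport (W t₀) := by
        ext i
        simp [mem_wordSupport, hu]
      refine ⟨?_, h2⟩
      rw [← hnorm, ← card_wordSupport, h2, card_wordSupport, hnorm, ht₀n]
  rw [this, Finset.card_image_of_injective _ (smul_left_injective K ht₀0),
    Finset.card_erase_of_mem (Finset.mem_univ _), Finset.card_univ]

theorem ncard_blocks_le_of_perm {D : Submodule K (ι → K)} {w : ℕ} (π : Equiv.Perm ι)
    (hπ : ∀ c ∈ D, c ∘ π ∈ D) (T : Finset ι) :
    {B ∈ supportsOfWeight D w | T.map π.toEmbedding ⊆ B}.ncard ≤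
      {B ∈ supportsOfWeight D w | T ⊆ B}.ncard := by
  classical
  refine Set.ncard_le_ncard_of_injOn (fun B => B.map π.symm.toEmbedding) ?_
    (Finset.map_injective _).injOn (Set.toFinite _)
  rintro _ ⟨⟨c, hc, hw, rfl⟩, hT⟩
  have hsup : wordSupport (c ∘ π) = (wordSupport c).map π.symm.toEmbedding := by
    ext i
    rw [mem_wordSupport, Finset.mem_map_equiv, mem_wordSupport]
    rfl
  refine ⟨⟨c ∘ π, hπ c hc, ?_, hsup⟩, ?_⟩
  · rw [← card_wordSupport, hsup, Finset.card_map, card_wordSupport, hw]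
  · intro i hi
    rw [Finset.mem_map_equiv]
    exact hT (Finset.mem_map_of_mem π.toEmbedding hi)

/-- The words of a fixed weight in a code with a doubly transitive automorphism group support a
`2`-design. -/
theorem exists_isTDesign (W : V →ₗ[K] (ι → K)) {w n : ℕ} (hw : w + n = Fintype.card ι)
    (hw2 : 2 < w) (hn : 0 < n)
    (htrans : ∀ x y x' y' : ι, x ≠ y → x' ≠ y' → ∃ π : Equiv.Perm ι, π x = x' ∧ π y = y' ∧
      ∀ c ∈ LinearMap.range W, c ∘ π ∈ LinearMap.range W)
    (hz : ∀ t, t ≠ 0 → ((Fintype.card K : ℤ) - 1) * numZeros (W t) <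
      Fintype.card ι + (Fintype.card K - 2) * n) :
    ∃ lam : ℕ, IsTDesign (supportsOfWeight (LinearMap.range W) w) 2 (Fintype.card ι) w lam ∧
      (lam : ℚ) * (Fintype.card ι * (Fintype.card ι - 1)) * (Fintype.card K - 1) =
        (Finset.univ.filter fun t => numZeros (W t) = n).card * (w * (w - 1)) := by
  classical
  set 𝓑 := supportsOfWeight (LinearMap.range W) w with h𝓑
  obtain ⟨T₀, -, hT₀⟩ := Finset.exists_subset_card_eq (s := (Finset.univ : Finset ι)) (n := 2)
    (by rw [Finset.card_univ]; omega)
  have hle : ∀ T T' : Finset ι, T.card = 2 → T'.card = 2 →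
      {B ∈ 𝓑 | T' ⊆ B}.ncard ≤ {B ∈ 𝓑 | T ⊆ B}.ncard := by
    intro T T' hT hT'
    obtain ⟨x, y, hxy, rfl⟩ := Finset.card_eq_two.1 hT
    obtain ⟨x', y', hxy', rfl⟩ := Finset.card_eq_two.1 hT'
    obtain ⟨π, hx, hy, hπ⟩ := htrans x y x' y' hxy hxy'
    have := ncard_blocks_le_of_perm (w := w) π hπ {x, y}
    rwa [Finset.map_insert, Finset.map_singleton, Equiv.coe_toEmbedding, hx, hy] at this
  have hblock : ∀ B ∈ 𝓑, B.card = w := by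
    rintro _ ⟨c, _, hc, rfl⟩
    rw [card_wordSupport, hc]
  set lam := {B ∈ 𝓑 | T₀ ⊆ B}.ncard with hlam
  have hbal : ∀ T : Finset ι, T.card = 2 → {B ∈ 𝓑 | T ⊆ B}.ncard = lam := fun T hT =>
    le_antisymm (hle _ _ hT₀ hT) (hle _ _ hT hT₀)
  refine ⟨lam, ⟨rfl, two_pos, hw2, by omega, hblock, hbal⟩, ?_⟩
  -- Double counting of the pairs of a 2-subset and a block containing it.
  have hcount := Finset.sum_card_bipartiteAbove_eq_sum_card_bipartiteBelow
    (s := Finset.powersetCard 2 (Finset.univ : Finset ι))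
    (t := Finset.univ.filter fun B => B ∈ 𝓑) (fun T B => T ⊆ B)
  have hL : ∀ T ∈ Finset.powersetCard 2 (Finset.univ : Finset ι),
      ((Finset.univ.filter fun B => B ∈ 𝓑).bipartiteAbove (fun T B => T ⊆ B) T).card = lam := by
    intro T hT
    rw [← hbal T (Finset.mem_powersetCard.1 hT).2, ← Set.ncard_coe_finset]
    congr 1
    ext B
    simp [Finset.bipartiteAbove]
  have hR : ∀ B ∈ Finset.univ.filter fun B => B ∈ 𝓑,
      ((Finset.powersetCard 2 (Finset.univ : Finset ι)).bipartiteBelow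
        (fun T B => T ⊆ B) B).card = w.choose 2 := by
    intro B hB
    rw [← hblock B (Finset.mem_filter.1 hB).2, ← Finset.card_powersetCard]
    congr 1
    ext T
    simp [Finset.bipartiteBelow, Finset.mem_powersetCard, and_comm]
  rw [Finset.sum_congr rfl hL, Finset.sum_congr rfl hR, Finset.sum_const, Finset.sum_const,
    Finset.card_powersetCard, Finset.card_univ, smul_eq_mul, smul_eq_mul] at hcount
  have hb : (Finset.univ.filter fun B => B ∈ 𝓑).card = 𝓑.ncard := by
    rw [← Set.ncard_coe_finset]
    congr 1
    ext B
    simp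
  have hA := card_supportsOfWeight W hw (by omega) hz
  rw [← h𝓑] at hA
  rw [hb] at hcount
  have hcount' := congrArg (Nat.cast : ℕ → ℚ) hcount
  have hA' := congrArg (Nat.cast : ℕ → ℚ) hA
  rw [Nat.cast_mul, Nat.cast_sub Fintype.card_pos] at hA'
  push_cast [Nat.cast_choose_two] at hcount' hA'
  rw [← hA']
  linear_combination 2 * ((Fintype.card K : ℚ) - 1) * hcount'

end DesignsFromCodes

/-! ### Invariance of the trace code under affine maps. -/

section AffineInvariance

variable {p : ℕ} [Fact p.Prime] {F : Type*} [Field F] [Fintype F] [Algebra (ZMod p) F]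
  (s : F ≃ₐ[ZMod p] F)

theorem comp_affine_mem_affineTraceCode {c : F → ZMod p} (hc : c ∈ affineTraceCode s) (u v : F) :
    (fun z => c (u * z + v)) ∈ affineTraceCode s := by
  obtain ⟨⟨a, b, h⟩, rfl⟩ := hc
  refine ⟨(a * (u * s u), polarMap s a v * u + b * u,
    quadTrace s a v + Algebra.trace (ZMod p) F (b * v) + h), ?_⟩
  ext z
  have h1 : quadTrace s (a * (u * s u)) z = quadTrace s a (u * z) := by
    rw [quadTrace, quadTrace, map_mul s]
    congr 1
    ring
  simp only [affineTraceWord_apply, quadTrace_add, h1, add_mul, mul_add, map_add, mul_assoc]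
  ring

theorem exists_affine_perm {x y x' y' : F} (h : x ≠ y) (h' : x' ≠ y') :
    ∃ (π : Equiv.Perm F) (u v : F), π x = x' ∧ π y = y' ∧ ∀ z, π z = u * z + v := by
  have h1 : x - y ≠ 0 := sub_ne_zero.2 h
  have h2 : x' - y' ≠ 0 := sub_ne_zero.2 h'
  refine ⟨(Equiv.mulLeft₀ ((x' - y') / (x - y)) (div_ne_zero h2 h1)).trans
    (Equiv.addRight (x' - (x' - y') / (x - y) * x)), (x' - y') / (x - y),
    x' - (x' - y') / (x - y) * x, ?_, ?_, fun z => rfl⟩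
  · simp
  · simp only [Equiv.trans_apply, Equiv.mulLeft₀_apply, Equiv.coe_addRight]
    field_simp
    ring

variable {ι : Type*} [Fintype ι] (e : ι ≃ F)

/-- The affine trace words, with the coordinates labelled by `e`. -/
noncomputable def labelledTraceWord : F × F × ZMod p →ₗ[ZMod p] (ι → ZMod p) :=
  LinearMap.funLeft (ZMod p) (ZMod p) e ∘ₗ affineTraceWord s

theorem numZeros_labelledTraceWord (t : F × F × ZMod p) :
    numZeros (labelledTraceWord s e t) = zeroCount s t.1 t.2.1 t.2.2 :=
  Finset.card_equiv e fun i => by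
    simp only [Finset.mem_filter, Finset.mem_univ, true_and]
    rfl

theorem doubly_transitive_labelledTraceWord (x y x' y' : ι) (h : x ≠ y) (h' : x' ≠ y') :
    ∃ π : Equiv.Perm ι, π x = x' ∧ π y = y' ∧
      ∀ c ∈ LinearMap.range (labelledTraceWord s e),
        c ∘ π ∈ LinearMap.range (labelledTraceWord s e) := by
  obtain ⟨π, u, v, hx, hy, hπ⟩ := exists_affine_perm (e.injective.ne h) (e.injective.ne h')
  refine ⟨e.trans (π.trans e.symm), by simp [hx], by simp [hy], ?_⟩
  rintro _ ⟨t, rfl⟩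
  obtain ⟨t', ht'⟩ := comp_affine_mem_affineTraceCode s ⟨t, rfl⟩ u v
  refine ⟨t', ?_⟩
  ext i
  have := congrFun ht' (e i)
  rw [← hπ] at this
  simpa [labelledTraceWord, LinearMap.funLeft_apply] using this

end AffineInvariance

/-! ### Counting all words by their zeros. -/

section CodewordCounts

variable {p : ℕ} [Fact p.Prime] {F : Type*} [Field F] [Fintype F] [Algebra (ZMod p) F]

theorem levelCount_zero_left (s : F ≃ₐ[ZMod p] F) (c : ZMod p) :
    levelCount s 0 c = if c = 0 then Fintype.card F else 0 := by
  split_ifs with h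
  · subst h
    simp [levelCount, quadTrace_zero_left]
  · simp [levelCount, quadTrace_zero_left, Ne.symm h]

theorem polarMap_zero (s : F ≃ₐ[ZMod p] F) : polarMap s 0 = 0 := by
  ext x
  simp [polarMap_apply]

/-- The number of parameters `(a, b, h)` whose word has `n` zeros. -/
noncomputable def wordCount (s : F ≃ₐ[ZMod p] F) (n : ℕ) : ℕ :=
  (Finset.univ.filter fun t : F × F × ZMod p => zeroCount s t.1 t.2.1 t.2.2 = n).card

-- The case `a = 0` is split off: its polar map has range `{0}` and its level sets have size `0` or
-- `q`, excluded by the bounds on `n`, so only `b ≠ 0` contributes.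
open Classical in
theorem wordCount_eq (hp : p ≠ 2) (s : F ≃ₐ[ZMod p] F) {n : ℕ} (hn : 0 < n)
    (hnF : n < Fintype.card F) :
    (wordCount s n : ℤ) = (Fintype.card F - 1) * (if p * n = Fintype.card F then p else 0 : ℕ) +
      ∑ a ∈ Finset.univ.erase (0 : F),
        ((Nat.card (LinearMap.range (polarMap s a)) : ℤ) * levelCountFreq s a n +
        ((Fintype.card F : ℤ) - Nat.card (LinearMap.range (polarMap s a))) *
          (if p * n = Fintype.card F then p else 0 : ℕ)) := by
  have h1 : wordCount s n = ∑ a : F,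
      (Finset.univ.filter fun t : F × ZMod p => zeroCount s a t.1 t.2 = n).card := by
    rw [wordCount]
    simp only [Finset.card_filter, ← Finset.univ_product_univ (α := F) (β := F × ZMod p),
      Finset.sum_product]
  have h2 : levelCountFreq s 0 n = 0 := by
    rw [levelCountFreq, Finset.card_eq_zero]
    refine Finset.filter_false_of_mem fun c _ => ?_
    rw [levelCount_zero_left]
    split_ifs <;> omega
  have h3 : Nat.card (LinearMap.range (polarMap s 0)) = 1 := by
    rw [polarMap_zero, LinearMap.range_zero]
    simp
  rw [h1, ← Finset.add_sum_erase _ _ (Finset.mem_univ (0 : F))]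
  push_cast
  rw [card_zeroCount_eq s hp 0 n, h2, h3, Finset.sum_congr rfl fun a _ => card_zeroCount_eq s hp a n]
  push_cast
  ring

theorem card_range_polarMap_of_card_ker {s : F ≃ₐ[ZMod p] F} {a : F}
    (h : Nat.card (LinearMap.ker (polarMap s a)) = 1) :
    Nat.card (LinearMap.range (polarMap s a)) = Fintype.card F := by
  have := card_range_mul_card_ker s a
  rwa [h, mul_one] at this

/-- A zero bound for all nonzero words from the bounds for the quadratic forms. -/
theorem mul_zeroCount_lt (hp : p ≠ 2) (s : F ≃ₐ[ZMod p] F) {n : ℕ} (hn : 0 < n)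
    (hlev : ∀ a : F, a ≠ 0 → ∀ c : ZMod p, ((p : ℤ) - 1) * levelCount s a c <
      Fintype.card F + (p - 2) * n) {t : F × F × ZMod p} (ht : t ≠ 0) :
    ((p : ℤ) - 1) * zeroCount s t.1 t.2.1 t.2.2 < Fintype.card F + (p - 2) * n := by
  obtain ⟨a, b, h⟩ := t
  have hp3 : (3 : ℤ) ≤ p := by
    have := (Fact.out : p.Prime).two_le
    omega
  have hn' : (0 : ℤ) < n := by exact_mod_cast hn
  have hq : (0 : ℤ) < Fintype.card F := by exact_mod_cast Fintype.card_pos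
  by_cases hb : b ∈ LinearMap.range (polarMap s a)
  · obtain ⟨x₀, rfl⟩ := hb
    simp only [zeroCount_polarMap]
    -- For `a = 0` the linear part vanishes as well, and the word is a nonzero constant without
    -- zeros.
    by_cases ha : a = 0
    · subst ha
      rw [polarMap_zero] at ht
      have hh : h ≠ 0 := by
        rintro rfl
        exact ht rfl
      rw [quadTrace_zero_left, levelCount_zero_left, if_neg (by simpa using hh)]
      push_cast
      nlinarith
    · exact hlev a ha _
  · have := congrArg (Nat.cast : ℕ → ℤ) (zeroCount_of_notMem_range s hp hb h)
    push_cast at this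
    simp only
    nlinarith

end CodewordCounts

/-! ### The design criterion for the code, in terms of `wordCount`. -/

section MainDesign

variable {p : ℕ} [Fact p.Prime] {F : Type*} [Field F] [Fintype F] [Algebra (ZMod p) F] {m l : ℕ}

theorem exists_label (hp : p ≠ 2) (hF : Fintype.card F = p ^ m)
    {α : F} (hα : IsPrimitiveRoot α (p ^ m - 1)) :
    ∃ e : Fin (p ^ m - 1 + 1) ≃ F,
      codeC2Bar p m l α = LinearMap.range (labelledTraceWord (frobPow p F l) e) := by
  have hn1 : Fintype.card F = p ^ m - 1 + 1 := by
    rw [hF, Nat.sub_add_cancel (Nat.one_le_pow _ _ (Fact.out : p.Prime).pos)]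
  refine ⟨Equiv.ofBijective _ (labelFun_bijective hα hn1), ?_⟩
  rw [codeC2Bar_eq hp hF hα, labelledTraceWord, LinearMap.range_comp]
  rfl

theorem holdsDesign_codeC2Bar (hp : p ≠ 2) (hF : Fintype.card F = p ^ m)
    {α : F} (hα : IsPrimitiveRoot α (p ^ m - 1)) {w n : ℕ} (hwn : w + n = p ^ m) (hw2 : 2 < w)
    (hn : 0 < n)
    (hlev : ∀ a : F, a ≠ 0 → ∀ c : ZMod p, ((p : ℤ) - 1) * levelCount (frobPow p F l) a c <
      p ^ m + (p - 2) * n) {i lam : ℚ} (hi : (w : ℚ) = i)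
    (hlam : lam * ((p : ℚ) ^ m * ((p : ℚ) ^ m - 1)) * (p - 1) =
      wordCount (frobPow p F l) n * (w * (w - 1))) :
    HoldsDesign (codeC2Bar p m l α) 2 (p ^ m) i lam := by
  obtain ⟨e, he⟩ := exists_label (l := l) hp hF hα
  have hι : Fintype.card (Fin (p ^ m - 1 + 1)) = p ^ m := by
    rw [Fintype.card_fin, Nat.sub_add_cancel (Nat.one_le_pow _ _ (Fact.out : p.Prime).pos)]
  obtain ⟨L, hL, hcount⟩ := exists_isTDesign (labelledTraceWord (frobPow p F l) e)
    (by rw [hι, hwn]) hw2 hn (doubly_transitive_labelledTraceWord _ e) (fun t ht => by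
      rw [ZMod.card, hι, numZeros_labelledTraceWord]
      have := mul_zeroCount_lt hp (frobPow p F l) hn (fun a ha c => by
        rw [hF]
        exact_mod_cast hlev a ha c) ht
      rw [hF] at this
      exact this)
  rw [← he, hι] at hL
  refine ⟨w, L, hi, ?_, hL⟩
  simp only [numZeros_labelledTraceWord, hι, ZMod.card] at hcount
  have h1 : (1 : ℚ) < p := by exact_mod_cast (Fact.out : p.Prime).one_lt
  have h2 : (1 : ℚ) < (p : ℚ) ^ m := by
    have := Fintype.one_lt_card (α := F)
    rw [hF] at this
    exact_mod_cast this
  have h3 : (p : ℚ) ^ m * ((p : ℚ) ^ m - 1) * (p - 1) ≠ 0 :=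
    mul_ne_zero (mul_ne_zero (by linarith) (by linarith)) (by linarith)
  refine mul_right_cancel₀ h3 ?_
  push_cast at hcount
  rw [wordCount] at hlam
  linear_combination hcount - hlam

end MainDesign

/-! ### The designs for odd `m`. -/

section OddDesigns

variable {p : ℕ} [Fact p.Prime] {F : Type*} [Field F] [Fintype F] [Algebra (ZMod p) F] {k l : ℕ}

theorem three_le_of_ne_two (hp : p ≠ 2) : 3 ≤ p := by
  have := (Fact.out : p.Prime).two_le
  omega

/-- For `a ≠ 0` the polar map is bijective, so every `b` contributes `f`. The remaining term comes
from `a = 0`, `b ≠ 0`, where each of the `p` constants `h` gives `q/p` zeros. -/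
theorem wordCount_of_odd (hp : p ≠ 2) (hF : Fintype.card F = p ^ (2 * k + 1)) {n : ℕ} (hn : 0 < n)
    (hnF : n < p ^ (2 * k + 1)) {f : ℕ}
    (hf : ∀ a : F, a ≠ 0 → levelCountFreq (frobPow p F l) a n = f) :
    (wordCount (frobPow p F l) n : ℤ) = (p ^ (2 * k + 1) - 1) *
      (p ^ (2 * k + 1) * f + (if n = p ^ (2 * k) then p else 0 : ℕ)) := by
  classical
  have hcond : p * n = Fintype.card F ↔ n = p ^ (2 * k) := by
    rw [hF, pow_succ', Nat.mul_right_inj (Fact.out : p.Prime).ne_zero]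
  rw [wordCount_eq hp _ hn (hF ▸ hnF), Finset.sum_congr rfl fun a ha => by
    rw [hf a (Finset.ne_of_mem_erase ha), card_range_polarMap_of_card_ker
      (card_ker_polarMap_of_odd hp hF (odd_two_mul_add_one k) (Finset.ne_of_mem_erase ha))],
    Finset.sum_const, Finset.card_erase_of_mem (Finset.mem_univ _), Finset.card_univ, nsmul_eq_mul,
    Nat.cast_sub Fintype.card_pos, sub_self, zero_mul, add_zero]
  simp only [hcond]
  rw [hF]
  push_cast
  ring

theorem levelCount_lt_of_odd (hp : p ≠ 2) (hF : Fintype.card F = p ^ (2 * k + 1)) (hk : k ≠ 0)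
    (hml : Nat.Coprime (2 * k + 1) l) {n : ℕ} {e : ℤ} (he : e = 0 ∨ e = 1 ∨ e = -1)
    (hn : (n : ℤ) = p ^ (2 * k) + e * p ^ k) {a : F} (ha : a ≠ 0) (c : ZMod p) :
    ((p : ℤ) - 1) * levelCount (frobPow p F l) a c < p ^ (2 * k + 1) + (p - 2) * n := by
  have hp3 : (3 : ℤ) ≤ p := by exact_mod_cast three_le_of_ne_two hp
  have hS : (p : ℤ) ≤ p ^ k := le_self_pow₀ (by linarith) hk
  have h1 : (levelCount (frobPow p F l) a c : ℤ) ≤ p ^ (2 * k) + p ^ k := by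
    by_cases hc : c = 0
    · subst hc
      rw [levelCount_zero_of_odd hp hF hml (odd_two_mul_add_one k) ha]
      push_cast
      linarith
    · have := levelCount_of_odd hp hF hml (odd_two_mul_add_one k) ha hc
      rw [Nat.add_sub_cancel, Nat.mul_div_cancel_left _ two_pos] at this
      rcases this with h | h <;> linarith
  have h2 : (p : ℤ) ^ (2 * k) - p ^ k ≤ n := by
    rcases he with rfl | rfl | rfl <;> linarith
  have h3 : (p : ℤ) ^ (2 * k) = p ^ k * p ^ k := by rw [two_mul, pow_add]
  rw [pow_succ, h3]
  rw [h3] at h1 h2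
  nlinarith [mul_le_mul_of_nonneg_left h1 (by linarith : (0 : ℤ) ≤ p - 1),
    mul_le_mul_of_nonneg_left h2 (by linarith : (0 : ℤ) ≤ p - 2),
    mul_le_mul_of_nonneg_left hS (by nlinarith : (0 : ℤ) ≤ (p - 1) * p ^ k)]

/-- The designs of the code for odd `m = 2 k + 1`, from the number of parameters. -/
theorem holdsDesign_of_odd (hp : p ≠ 2) (hF : Fintype.card F = p ^ (2 * k + 1)) (hk : k ≠ 0)
    (hml : Nat.Coprime (2 * k + 1) l) {α : F} (hα : IsPrimitiveRoot α (p ^ (2 * k + 1) - 1))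
    {e : ℤ} (he : e = 0 ∨ e = 1 ∨ e = -1) {i lam : ℚ}
    (hi : i = p ^ (2 * k + 1) - p ^ (2 * k) - e * p ^ k)
    (hlam : 2 * lam * p ^ (2 * k + 1) * (p - 1) =
      (if e = 0 then 2 * ((p : ℚ) ^ (2 * k + 1) + p) else (p : ℚ) ^ (2 * k + 1) * (p - 1)) * (i * (i - 1))) :
    HoldsDesign (codeC2Bar p (2 * k + 1) l α) 2 (p ^ (2 * k + 1)) i lam := by
  have hm := odd_two_mul_add_one k
  have hp3 : (3 : ℤ) ≤ p := by exact_mod_cast three_le_of_ne_two hp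
  have hS : (p : ℤ) ≤ p ^ k := le_self_pow₀ (by linarith) hk
  have h3 : (p : ℤ) ^ (2 * k) = p ^ k * p ^ k := by rw [two_mul, pow_add]
  have hn0 : (0 : ℤ) < p ^ (2 * k) + e * p ^ k := by
    rw [h3]
    rcases he with rfl | rfl | rfl <;> nlinarith
  have hw0 : (2 : ℤ) < p ^ (2 * k + 1) - (p ^ (2 * k) + e * p ^ k) := by
    rw [pow_succ, h3]
    have : (3 : ℤ) * (p ^ k * p ^ k) ≤ p ^ k * p ^ k * p := by nlinarith
    rcases he with rfl | rfl | rfl <;> nlinarith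
  obtain ⟨n, hn⟩ := Int.eq_ofNat_of_zero_le hn0.le
  obtain ⟨w, hw⟩ := Int.eq_ofNat_of_zero_le ((by norm_num : (0 : ℤ) ≤ 2).trans hw0.le)
  have hnw : w + n = p ^ (2 * k + 1) := by
    zify
    rw [← hw, ← hn]
    ring
  have hwi : (w : ℚ) = i := by
    have := congrArg (Int.cast : ℤ → ℚ) hw
    push_cast at this
    rw [← this, hi]
    ring
  refine holdsDesign_codeC2Bar hp hF hα hnw (by omega) (by omega)
    (fun a ha c => levelCount_lt_of_odd hp hF hk hml he hn.symm ha c) hwi ?_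
  rw [hwi]
  have hq : (p : ℤ) ^ k ≠ 0 := by
    have : (0 : ℤ) < p ^ k := by linarith
    exact this.ne'
  -- The parameter `e` is the deviation of the number of zeros from `q/p` in units of `p^k`. The
  -- hypothesis `hlam` uses the word count divided by `q - 1` and doubled: `2(q + p)` for `e = 0`,
  -- and `q(p - 1)` otherwise.
  by_cases he0 : e = 0
  · subst he0
    have hnQ : n = p ^ (2 * k) := by
      zify
      rw [← hn]
      ring
    have hA := wordCount_of_odd (l := l) (f := 1) (n := n) hp hF (by omega) (by omega) (fun a ha => by
      have := levelCountFreq_center_of_odd (l := l) hp hF hml hm ha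
      rwa [Nat.add_sub_cancel, ← hnQ] at this)
    rw [if_pos hnQ] at hA
    have hA' := congrArg (Int.cast : ℤ → ℚ) hA
    push_cast at hA'
    rw [hA']
    simp only [if_true] at hlam
    linear_combination ((p : ℚ) ^ (2 * k + 1) - 1) / 2 * hlam
  · have hnQ : n ≠ p ^ (2 * k) := by
      intro h
      rw [h] at hn
      push_cast at hn
      exact mul_ne_zero he0 hq (by linarith)
    have hfreq : ∀ a : F, a ≠ 0 → 2 * (levelCountFreq (frobPow p F l) a n : ℤ) = p - 1 := by
      intro a ha
      refine levelCountFreq_of_odd hp hF hml hm ha ?_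
      rw [Nat.add_sub_cancel, Nat.mul_div_cancel_left _ two_pos]
      rcases he with rfl | rfl | rfl
      · exact absurd rfl he0
      · left
        linarith
      · right
        linarith
    have hA := wordCount_of_odd (l := l) (f := levelCountFreq (frobPow p F l) 1 n) (n := n) hp hF
      (by omega) (by omega) (fun a ha => by
        have h1 := hfreq a ha
        have h2 := hfreq 1 one_ne_zero
        omega)
    rw [if_neg hnQ] at hA
    have h1 := congrArg (Int.cast : ℤ → ℚ) (hfreq 1 one_ne_zero)
    have hA' := congrArg (Int.cast : ℤ → ℚ) hA
    push_cast at hA' h1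
    rw [hA']
    rw [if_neg he0] at hlam
    linear_combination ((p : ℚ) ^ (2 * k + 1) - 1) / 2 * hlam -
      ((p : ℚ) ^ (2 * k + 1) - 1) / 2 * p ^ (2 * k + 1) * (i * (i - 1)) * h1

end OddDesigns

/-! ### The designs for even `m`. -/

section EvenDesigns

variable {p : ℕ} [Fact p.Prime] {F : Type*} [Field F] [Fintype F] [Algebra (ZMod p) F] {k l : ℕ}

/-- The number of zeros of the value `0` and of the other values, when the radical is trivial. -/
theorem levelCount_of_even_of_nondegenerate (hp : p ≠ 2) (hF : Fintype.card F = p ^ (2 * k))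
    (hk : 2 ≤ k) (hml : Nat.Coprime (2 * k) l) {α : F}
    (hα : IsPrimitiveRoot α (p ^ (2 * k) - 1)) {a : F}
    (h : Nat.card (LinearMap.ker (polarMap (frobPow p F l) a)) = 1) :
    (levelCount (frobPow p F l) a 0 : ℤ) = p ^ (2 * k - 1) + (-(p - 1)) * (-p) ^ (k - 1) ∧
      ∀ c : ZMod p, c ≠ 0 →
        (levelCount (frobPow p F l) a c : ℤ) = p ^ (2 * k - 1) + 1 * (-p) ^ (k - 1) := by
  obtain ⟨h1, h2⟩ := levelCount_of_even (j := k - 1) hp hF (by omega) hml hα a (by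
    rw [h, mul_one]
    congr 1
    omega)
  exact ⟨by rw [h1]; ring, fun c hc => by rw [h2 c hc]; ring⟩

theorem levelCount_of_even_of_degenerate (hp : p ≠ 2) (hF : Fintype.card F = p ^ (2 * k))
    (hk : 2 ≤ k) (hml : Nat.Coprime (2 * k) l) {α : F}
    (hα : IsPrimitiveRoot α (p ^ (2 * k) - 1)) {a : F}
    (h : Nat.card (LinearMap.ker (polarMap (frobPow p F l) a)) = p ^ 2) :
    (levelCount (frobPow p F l) a 0 : ℤ) = p ^ (2 * k - 1) + (p * (p - 1)) * (-p) ^ (k - 1) ∧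
      ∀ c : ZMod p, c ≠ 0 →
        (levelCount (frobPow p F l) a c : ℤ) = p ^ (2 * k - 1) + (-p) * (-p) ^ (k - 1) := by
  obtain ⟨h1, h2⟩ := levelCount_of_even (j := k) hp hF (by omega) hml hα a (by
    rw [h, ← pow_add])
  have hpow : (-(p : ℤ)) ^ k = (-p) * (-p) ^ (k - 1) := (mul_pow_sub_one (by omega) _).symm
  rw [hpow] at h1 h2
  exact ⟨by rw [h1]; ring, h2⟩

theorem card_ker_polarMap_of_even (hp : p ≠ 2) (hF : Fintype.card F = p ^ (2 * k))
    (hml : Nat.Coprime (2 * k) l) {α : F}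
    (hα : IsPrimitiveRoot α (p ^ (2 * k) - 1)) {a : F} (ha : a ≠ 0) :
    Nat.card (LinearMap.ker (polarMap (frobPow p F l) a)) = 1 ∨
      Nat.card (LinearMap.ker (polarMap (frobPow p F l) a)) = p ^ 2 := by
  have hl : Odd l := Nat.coprime_two_left.1 (Nat.Coprime.coprime_mul_right hml)
  obtain ⟨z₀, hz₀, hz⟩ := exists_skew_element hp hF hl hα
  exact card_ker_polarMap_eq_or _ hp
    (fun x => exists_algebraMap_eq_of_frobPow_eq (x := x) hF hml) hz₀ hz ha

/-- Of the `q - 1` nonzero `a`, a fraction `1/(p+1)` is degenerate with polar range of size `q/p^2`,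
and a fraction `p/(p+1)` is nondegenerate with full range. The factor `p + 1` clears these
fractions. -/
theorem wordCount_of_even (hp : p ≠ 2) (hF : Fintype.card F = p ^ (2 * k)) (hk : 2 ≤ k)
    (hml : Nat.Coprime (2 * k) l) {α : F} (hα : IsPrimitiveRoot α (p ^ (2 * k) - 1)) {n : ℕ}
    (hn : 0 < n) (hnF : n < p ^ (2 * k)) {f g d : ℤ}
    (hf : ∀ a : F, a ≠ 0 → Nat.card (LinearMap.ker (polarMap (frobPow p F l) a)) = 1 →
      (levelCountFreq (frobPow p F l) a n : ℤ) = f)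
    (hg : ∀ a : F, a ≠ 0 → Nat.card (LinearMap.ker (polarMap (frobPow p F l) a)) = p ^ 2 →
      (levelCountFreq (frobPow p F l) a n : ℤ) = g)
    (hd : ((if p * n = Fintype.card F then p else 0 : ℕ) : ℤ) = d) :
    ((p : ℤ) + 1) * wordCount (frobPow p F l) n = (p ^ (2 * k) - 1) *
      ((p + 1) * d + p * (p ^ (2 * k) * f) +
        (p ^ (2 * k - 2) * g + (p ^ (2 * k) - p ^ (2 * k - 2)) * d)) := by
  classical
  have hl : Odd l := Nat.coprime_two_left.1 (Nat.Coprime.coprime_mul_right hml)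
  obtain ⟨z₀, hz₀, hz⟩ := exists_skew_element hp hF hl hα
  have hdeg := card_degenerate _ hp
    (fun x => exists_algebraMap_eq_of_frobPow_eq (x := x) hF hml) hz₀ hz
  set A := Finset.univ.filter fun a : F => a ≠ 0 ∧
      Nat.card (LinearMap.ker (polarMap (frobPow p F l) a)) = p ^ 2 with hA
  have hp' := (Fact.out : p.Prime)
  have hAe : (Finset.univ.erase (0 : F)).filter
      (fun a => Nat.card (LinearMap.ker (polarMap (frobPow p F l) a)) = p ^ 2) = A := by
    ext a
    simp [hA]
  have hterm : ∀ a ∈ Finset.univ.erase (0 : F),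
      ((Nat.card (LinearMap.range (polarMap (frobPow p F l) a)) : ℤ) *
          levelCountFreq (frobPow p F l) a n +
        ((Fintype.card F : ℤ) - Nat.card (LinearMap.range (polarMap (frobPow p F l) a))) *
          (if p * n = Fintype.card F then p else 0 : ℕ)) =
      if Nat.card (LinearMap.ker (polarMap (frobPow p F l) a)) = p ^ 2 then
        (p : ℤ) ^ (2 * k - 2) * g + (p ^ (2 * k) - p ^ (2 * k - 2)) * d
      else (p : ℤ) ^ (2 * k) * f := by
    intro a ha
    have ha0 := Finset.ne_of_mem_erase ha
    rw [hd]
    split_ifs with h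
    · have hr := card_range_mul_card_ker (frobPow p F l) a
      rw [h, hF, ← Nat.sub_add_cancel (by omega : 2 ≤ 2 * k), pow_add] at hr
      have hr' := Nat.eq_of_mul_eq_mul_right (pow_pos hp'.pos 2) hr
      rw [hr', hg a ha0 h, hF]
      push_cast
      rfl
    · have h1 := (card_ker_polarMap_of_even hp hF hml hα ha0).resolve_right h
      rw [card_range_polarMap_of_card_ker h1, hf a ha0 h1, hF]
      push_cast
      ring
  have hsplit := Finset.card_filter_add_card_filter_not (s := Finset.univ.erase (0 : F))
    (fun a => Nat.card (LinearMap.ker (polarMap (frobPow p F l) a)) = p ^ 2)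
  rw [hAe, Finset.card_erase_of_mem (Finset.mem_univ _), Finset.card_univ, hF] at hsplit
  have h := wordCount_eq hp (frobPow p F l) hn (hF ▸ hnF)
  rw [Finset.sum_congr rfl hterm, Finset.sum_ite, Finset.sum_const, Finset.sum_const, hAe, hd, hF,
    nsmul_eq_mul, nsmul_eq_mul] at h
  rw [hF] at hdeg
  generalize (Finset.filter (fun a => ¬ Nat.card (LinearMap.ker (polarMap (frobPow p F l) a)) = p ^ 2)
    (Finset.univ.erase (0 : F))).card = M at h hsplit
  have hq1 : 1 ≤ p ^ (2 * k) := Nat.one_le_pow _ _ hp'.pos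
  zify [hq1] at hdeg hsplit
  rw [h]
  push_cast
  linear_combination ((p : ℤ) ^ (2 * k - 2) * g + (p ^ (2 * k) - p ^ (2 * k - 2)) * d -
    p ^ (2 * k) * f) * hdeg + ((p : ℤ) + 1) * (p ^ (2 * k) * f) * hsplit

/-- The multiplicity of the number of zeros `p ^ (2 k - 1) + τ (-p) ^ (k - 1)` among the level
counts. -/
theorem levelCountFreq_of_values (s : F ≃ₐ[ZMod p] F) {a : F} {Q t x y τ : ℤ} (ht : t ≠ 0)
    (h0 : (levelCount s a 0 : ℤ) = Q + x * t)
    (h1 : ∀ c : ZMod p, c ≠ 0 → (levelCount s a c : ℤ) = Q + y * t) {n : ℕ}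
    (hn : (n : ℤ) = Q + τ * t) :
    (levelCountFreq s a n : ℤ) = (if τ = x then 1 else 0) + if τ = y then (p : ℤ) - 1 else 0 := by
  have hM : ∀ c : ZMod p, c ≠ 0 → levelCount s a c = levelCount s a 1 := fun c hc => by
    zify
    rw [h1 c hc, h1 1 one_ne_zero]
  have key : ∀ (c : ZMod p) (z : ℤ), (levelCount s a c : ℤ) = Q + z * t →
      (levelCount s a c = n ↔ τ = z) := by
    intro c z hz
    zify
    rw [hz, hn, add_right_inj, mul_left_inj' ht, eq_comm]
  rw [levelCountFreq_of_const s a hM]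
  simp only [key 0 x h0, key 1 y (h1 1 one_ne_zero)]
  have := (Fact.out : p.Prime).one_le
  push_cast [this]
  rfl

/-- Size estimates for the numbers `p ^ (2 k - 1) + τ (-p) ^ (k - 1)`. -/
theorem even_zero_bounds {p : ℕ} {k : ℕ} (hp3 : (3 : ℤ) ≤ p) (hk : 2 ≤ k) {τ : ℤ} (hτ1 : -p ≤ τ)
    (hτ2 : τ ≤ p * (p - 1)) :
    (0 : ℤ) < p ^ (2 * k - 1) + τ * (-p) ^ (k - 1) ∧
    (2 : ℤ) < p ^ (2 * k) - (p ^ (2 * k - 1) + τ * (-p) ^ (k - 1)) ∧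
    ∀ τ' : ℤ, -p ≤ τ' → τ' ≤ p * (p - 1) →
      ((p : ℤ) - 1) * (p ^ (2 * k - 1) + τ' * (-p) ^ (k - 1)) <
        p ^ (2 * k) + (p - 2) * (p ^ (2 * k - 1) + τ * (-p) ^ (k - 1)) := by
  obtain ⟨T, hT⟩ : ∃ T : ℤ, T = p ^ (k - 1) := ⟨_, rfl⟩
  have hTp : (p : ℤ) ≤ T := hT ▸ le_self_pow₀ (by linarith) (by omega)
  have hQ : (p : ℤ) ^ (2 * k - 1) = p * T * T := by
    rw [hT, mul_assoc, ← pow_add, ← pow_succ']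
    congr 1
    omega
  have hq : (p : ℤ) ^ (2 * k) = p * (p ^ (2 * k - 1)) := (mul_pow_sub_one (by omega) _).symm
  obtain ⟨e, he, ht⟩ : ∃ e : ℤ, (e = 1 ∨ e = -1) ∧ (-(p : ℤ)) ^ (k - 1) = e * T :=
    ⟨(-1) ^ (k - 1), neg_one_pow_eq_or ℤ (k - 1), by rw [hT, ← mul_pow, neg_one_mul]⟩
  rw [hq, hQ, ht]
  generalize (p : ℤ) = P at *
  have hpp : P * P ≤ P * T := mul_le_mul_of_nonneg_left hTp (by linarith)
  have hP : 3 * P ≤ P * P := mul_le_mul_of_nonneg_right hp3 (by linarith)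
  have hτ : -(P * (P - 1)) ≤ τ * e ∧ τ * e ≤ P * (P - 1) := by
    rcases he with rfl | rfl <;> constructor <;> linarith
  refine ⟨?_, ?_, fun τ' h1 h2 => ?_⟩
  · have : 0 < (P * T + τ * e) * T := mul_pos (by linarith) (by linarith)
    linarith
  · have h1 : 2 * (P * T) ≤ (P - 1) * (P * T) :=
      mul_le_mul_of_nonneg_right (by linarith) (by linarith)
    have h2 : 1 * T ≤ ((P - 1) * (P * T) - τ * e) * T :=
      mul_le_mul_of_nonneg_right (by linarith) (by linarith)
    linarith
  · have h4 : (P - 1) * (P * P) ≤ (P - 1) * (P * T) :=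
      mul_le_mul_of_nonneg_left hpp (by linarith)
    have : 0 < ((P - 1) * (P * T) - (P - 1) * (τ' * e) + (P - 2) * (τ * e)) * T := by
      refine mul_pos ?_ (by linarith)
      -- For sign `1`, the extreme case `τ' = P(P - 1)`, `τ = -P`, `T = P` leaves a margin of only
      -- `P` in the bracket.
      rcases he with rfl | rfl
      · linarith [mul_le_mul_of_nonneg_left h2 (by linarith : 0 ≤ P - 1),
          mul_le_mul_of_nonneg_left hτ1 (by linarith : 0 ≤ P - 2)]
      · linarith [mul_le_mul_of_nonneg_left h1 (by linarith : 0 ≤ P - 1),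
          mul_le_mul_of_nonneg_left hτ2 (by linarith : 0 ≤ P - 2)]
    linarith

/-- The designs of the code for even `m = 2 k`, from the number of parameters. -/
theorem holdsDesign_of_even (hp : p ≠ 2) (hF : Fintype.card F = p ^ (2 * k)) (hk : 2 ≤ k)
    (hml : Nat.Coprime (2 * k) l) {α : F} (hα : IsPrimitiveRoot α (p ^ (2 * k) - 1))
    {τ : ℤ} (hτ1 : -p ≤ τ) (hτ2 : τ ≤ p * (p - 1)) {i lam : ℚ}
    (hi : i = p ^ (2 * k) - p ^ (2 * k - 1) - τ * (-p) ^ (k - 1)) {f g d : ℚ}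
    (hf : f = (if τ = -(p - 1) then 1 else 0) + if τ = 1 then (p : ℚ) - 1 else 0)
    (hg : g = (if τ = p * (p - 1) then 1 else 0) + if τ = -p then (p : ℚ) - 1 else 0)
    (hd : d = if τ = 0 then (p : ℚ) else 0)
    (hlam : lam * ((p : ℚ) ^ (2 * k) * (p - 1) * (p + 1)) =
      ((p + 1) * d + p * (p ^ (2 * k) * f) +
        (p ^ (2 * k - 2) * g + (p ^ (2 * k) - p ^ (2 * k - 2)) * d)) * (i * (i - 1))) :
    HoldsDesign (codeC2Bar p (2 * k) l α) 2 (p ^ (2 * k)) i lam := by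
  have hp3 : (3 : ℤ) ≤ p := by exact_mod_cast three_le_of_ne_two hp
  have hq : (p : ℤ) ^ (2 * k) = p * (p ^ (2 * k - 1)) := (mul_pow_sub_one (by omega) _).symm
  have ht0 : (-(p : ℤ)) ^ (k - 1) ≠ 0 := pow_ne_zero _ (by omega)
  have hpp : (3 : ℤ) * p ≤ p * p := mul_le_mul_of_nonneg_right hp3 (by linarith)
  obtain ⟨hn0, hw0, hbound⟩ := even_zero_bounds hp3 hk hτ1 hτ2
  obtain ⟨n, hn⟩ := Int.eq_ofNat_of_zero_le hn0.le
  obtain ⟨w, hw⟩ := Int.eq_ofNat_of_zero_le ((by norm_num : (0 : ℤ) ≤ 2).trans hw0.le)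
  have hnw : w + n = p ^ (2 * k) := by
    zify
    rw [← hw, ← hn]
    ring
  have hwi : (w : ℚ) = i := by
    have := congrArg (Int.cast : ℤ → ℚ) hw
    push_cast at this
    rw [← this, hi]
    ring
  rw [hn] at hbound
  have hlev : ∀ a : F, a ≠ 0 → ∀ c : ZMod p,
      ((p : ℤ) - 1) * levelCount (frobPow p F l) a c < p ^ (2 * k) + (p - 2) * n := by
    intro a ha c
    rcases card_ker_polarMap_of_even hp hF hml hα ha with h | h
    · obtain ⟨h1, h2⟩ := levelCount_of_even_of_nondegenerate hp hF hk hml hα h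
      by_cases hc : c = 0
      · subst hc
        rw [h1]
        exact hbound _ (by linarith) (by linarith)
      · rw [h2 c hc]
        exact hbound _ (by linarith) (by linarith)
    · obtain ⟨h1, h2⟩ := levelCount_of_even_of_degenerate hp hF hk hml hα h
      by_cases hc : c = 0
      · subst hc
        rw [h1]
        exact hbound _ (by linarith) le_rfl
      · rw [h2 c hc]
        exact hbound _ le_rfl (by linarith)
  refine holdsDesign_codeC2Bar hp hF hα hnw (by omega) (by omega) hlev hwi ?_
  have hcond : ((if p * n = Fintype.card F then p else 0 : ℕ) : ℤ) =
      if τ = 0 then (p : ℤ) else 0 := by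
    have : p * n = Fintype.card F ↔ τ = 0 := by
      rw [hF]
      zify
      rw [← hn, hq, mul_right_inj' (by omega : (p : ℤ) ≠ 0), add_eq_left, mul_eq_zero]
      exact or_iff_left ht0
    simp only [this]
    split_ifs <;> simp
  have hA := wordCount_of_even (n := n) hp hF hk hml hα (by omega) (by omega)
    (fun a _ h => by
      obtain ⟨h1, h2⟩ := levelCount_of_even_of_nondegenerate hp hF hk hml hα h
      exact levelCountFreq_of_values _ ht0 h1 h2 hn.symm)
    (fun a _ h => by
      obtain ⟨h1, h2⟩ := levelCount_of_even_of_degenerate hp hF hk hml hα h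
      exact levelCountFreq_of_values _ ht0 h1 h2 hn.symm) hcond
  have hA' := congrArg (Int.cast : ℤ → ℚ) hA
  push_cast at hA'
  rw [← hf, ← hg, ← hd] at hA'
  have hp1 : (p : ℚ) + 1 ≠ 0 := by positivity
  refine mul_left_cancel₀ hp1 ?_
  rw [hwi]
  linear_combination ((p : ℚ) ^ (2 * k) - 1) * hlam - i * (i - 1) * hA'

end EvenDesigns

/-! ### The theorem: specialization to the individual weights. -/

theorem theorem4p5 (p : ℕ) [Fact p.Prime] (hp : p ≠ 2) (m l : ℕ) (hm : 3 ≤ m) (hl : 1 ≤ l)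
    (hml : Nat.Coprime m l) (F : Type*) [Field F] [Fintype F] [Algebra (ZMod p) F]
    (hF : Fintype.card F = p ^ m) (α : F) (hα : IsPrimitiveRoot α (p ^ m - 1)) :
    -- the trace description of the code, for a labelling of the coordinates by the field
    (∃ e : Fin (p ^ m - 1 + 1) ≃ F, ∀ c : Fin (p ^ m - 1 + 1) → ZMod p,
      c ∈ codeC2Bar p m l α ↔ ∃ (a b : F) (h : ZMod p), ∀ i,
        c i = Algebra.trace (ZMod p) F (a * e i ^ (p ^ l + 1) + b * e i) + h) ∧
    (Odd m →
      HoldsDesign (codeC2Bar p m l α) 2 (p ^ m)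
        ((p : ℚ) ^ m - (p : ℚ) ^ (m - 1))
        (((p : ℚ) ^ m - (p : ℚ) ^ (m - 1) - 1) * ((p : ℚ) ^ (m - 1) + 1)) ∧
      HoldsDesign (codeC2Bar p m l α) 2 (p ^ m)
        ((p : ℚ) ^ m - (p : ℚ) ^ (m - 1) + (p : ℚ) ^ ((m - 1) / 2))
        (1 / 2 * (p : ℚ) ^ ((m - 1) / 2) *
          ((p : ℚ) ^ ((m + 1) / 2) - (p : ℚ) ^ ((m - 1) / 2) + 1) *
          ((p : ℚ) ^ m - (p : ℚ) ^ (m - 1) + (p : ℚ) ^ ((m - 1) / 2) - 1)) ∧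
      HoldsDesign (codeC2Bar p m l α) 2 (p ^ m)
        ((p : ℚ) ^ m - (p : ℚ) ^ (m - 1) - (p : ℚ) ^ ((m - 1) / 2))
        (1 / 2 * (p : ℚ) ^ ((m - 1) / 2) *
          ((p : ℚ) ^ ((m + 1) / 2) - (p : ℚ) ^ ((m - 1) / 2) - 1) *
          ((p : ℚ) ^ m - (p : ℚ) ^ (m - 1) - (p : ℚ) ^ ((m - 1) / 2) - 1))) ∧
    (Even m →
      HoldsDesign (codeC2Bar p m l α) 2 (p ^ m)
        ((p : ℚ) ^ m - (p : ℚ) ^ (m - 1))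
        (((p : ℚ) ^ m - (p : ℚ) ^ (m - 1) - 1) *
          ((p : ℚ) ^ (m - 1) - (p : ℚ) ^ (m - 2) + 1)) ∧
      HoldsDesign (codeC2Bar p m l α) 2 (p ^ m)
        ((p : ℚ) ^ (m / 2 - 1) * ((p : ℚ) - 1) * ((p : ℚ) ^ (m / 2) - (-1) ^ (m / 2)))
        ((p : ℚ) ^ (m / 2) * ((p : ℚ) ^ (m / 2) - (-1) ^ (m / 2)) *
          ((p : ℚ) ^ (m / 2 - 1) * ((p : ℚ) - 1) * ((p : ℚ) ^ (m / 2) - (-1) ^ (m / 2)) - 1) /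
          ((p : ℚ) + 1)) ∧
      HoldsDesign (codeC2Bar p m l α) 2 (p ^ m)
        ((p : ℚ) ^ (m / 2 - 1) * ((p : ℚ) ^ (m / 2) * ((p : ℚ) - 1) + (-1) ^ (m / 2)))
        ((p : ℚ) ^ (m / 2) * ((p : ℚ) ^ (m / 2) * ((p : ℚ) - 1) + (-1) ^ (m / 2)) *
          ((p : ℚ) ^ (m - 1) * ((p : ℚ) - 1) + (-1) ^ (m / 2) * (p : ℚ) ^ (m / 2 - 1) - 1) /
          ((p : ℚ) + 1)) ∧
      HoldsDesign (codeC2Bar p m l α) 2 (p ^ m)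
        ((p : ℚ) ^ (m / 2) * ((p : ℚ) - 1) * ((p : ℚ) ^ (m / 2 - 1) + (-1) ^ (m / 2)))
        ((p : ℚ) ^ (m / 2 - 2) * ((p : ℚ) ^ (m / 2 - 1) + (-1) ^ (m / 2)) *
          ((p : ℚ) ^ (m / 2) * ((p : ℚ) - 1) * ((p : ℚ) ^ (m / 2 - 1) + (-1) ^ (m / 2)) - 1) /
          ((p : ℚ) + 1)) ∧
      HoldsDesign (codeC2Bar p m l α) 2 (p ^ m)
        ((p : ℚ) ^ (m / 2) * ((p : ℚ) ^ (m / 2 - 1) * ((p : ℚ) - 1) - (-1) ^ (m / 2)))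
        ((p : ℚ) ^ (m / 2 - 2) * ((p : ℚ) ^ (m / 2 - 1) * ((p : ℚ) - 1) - (-1) ^ (m / 2)) *
          ((p : ℚ) ^ (m - 1) * ((p : ℚ) - 1) - (-1) ^ (m / 2) * (p : ℚ) ^ (m / 2) - 1) /
          ((p : ℚ) + 1))) := by
  refine ⟨?_, ?_, ?_⟩
  · obtain ⟨e, he⟩ := exists_label (l := l) hp hF hα
    have hval : ∀ (t : F × F × ZMod p) i, labelledTraceWord (frobPow p F l) e t i =
        Algebra.trace (ZMod p) F (t.1 * e i ^ (p ^ l + 1) + t.2.1 * e i) + t.2.2 := by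
      intro t i
      rw [map_add, pow_succ', ← frobPow_apply]
      rfl
    refine ⟨e, fun c => ?_⟩
    rw [he]
    constructor
    · rintro ⟨t, rfl⟩
      exact ⟨t.1, t.2.1, t.2.2, hval t⟩
    · rintro ⟨a, b, h, hc⟩
      exact ⟨(a, b, h), funext fun i => (hval _ i).trans (hc i).symm⟩
  · rintro ⟨k, rfl⟩
    have hk : k ≠ 0 := by omega
    rw [Nat.add_sub_cancel, Nat.mul_div_cancel_left _ two_pos,
      show (2 * k + 1 + 1) / 2 = k + 1 by omega]
    -- Since `e` measures the surplus of zeros, the larger weight belongs to `e = -1`.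
    refine ⟨holdsDesign_of_odd (e := 0) hp hF hk hml hα (by simp) ?_ ?_,
      holdsDesign_of_odd (e := -1) hp hF hk hml hα (by simp) ?_ ?_,
      holdsDesign_of_odd (e := 1) hp hF hk hml hα (by simp) ?_ ?_⟩
    · push_cast
      ring
    · rw [if_pos rfl]
      ring
    · push_cast
      ring
    · rw [if_neg (by norm_num)]
      ring
    · push_cast
      ring
    · rw [if_neg (by norm_num)]
      ring
  · rintro ⟨r, hr⟩
    obtain ⟨j, rfl⟩ : ∃ j, m = 2 * (j + 2) := ⟨r - 2, by omega⟩
    have hp3 : (3 : ℤ) ≤ p := by exact_mod_cast three_le_of_ne_two hp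
    have hX : (6 : ℤ) ≤ p * (p - 1) := by nlinarith
    have hp1 : (p : ℚ) + 1 ≠ 0 := by positivity
    rw [Nat.mul_div_cancel_left _ two_pos, show j + 2 - 1 = j + 1 by omega,
      show j + 2 - 2 = j by omega]
    have key := fun {τ : ℤ} => holdsDesign_of_even (k := j + 2) (τ := τ) hp hF (by omega) hml hα
    rw [show j + 2 - 1 = j + 1 by omega, neg_pow] at key
    have h1 : 2 * (j + 2) - 1 = 2 * j + 3 := by omega
    have h2 : 2 * (j + 2) - 2 = 2 * j + 2 := by omega
    simp only [h1, h2, pow_succ (-1 : ℚ) (j + 1), pow_succ (-1 : ℚ) j] at key ⊢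
    -- With `k = j + 2` the sign is `ε = (-1)^j`, while `(-p)^(k-1) = -ε p^(k-1)`.
    rcases neg_one_pow_eq_or ℚ j with he | he <;> simp only [he] at key ⊢
    all_goals
      -- The number of zeros is `p^(2k-1) + τ(-p)^(k-1)`. The values `-(p-1)` and `1` of `τ` are the
      -- zero and nonzero levels of nondegenerate forms, `p(p-1)` and `-p` those of degenerate ones,
      -- and `0` comes from `b` outside the range.
      refine ⟨key (τ := 0) (f := 0) (g := 0) (d := p) (by omega) (by omega) ?_ ?_ ?_ ?_ ?_,
        key (τ := -(p - 1)) (f := 1) (g := 0) (d := 0) (by omega) (by omega) ?_ ?_ ?_ ?_ ?_,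
        key (τ := 1) (f := p - 1) (g := 0) (d := 0) (by omega) (by omega) ?_ ?_ ?_ ?_ ?_,
        key (τ := p * (p - 1)) (f := 0) (g := 1) (d := 0) (by omega) (by omega) ?_ ?_ ?_ ?_ ?_,
        key (τ := -p) (f := 0) (g := p - 1) (d := 0) (by omega) (by omega) ?_ ?_ ?_ ?_ ?_⟩
    all_goals first
      | (push_cast; ring1)
      | (split_ifs <;> first | omega | ring1)
      | (field_simp; ring1)
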